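/- Let $d\ge 1$ and $r\ge 0$ be integers, let $\beta\in(0,1]$, and put $\alpha=r+\beta$ and $D=2\lceil\log_2(d+r)\rceil+2$. The unit ball of the Hölder space $\mathcal C^\alpha([0,1]^d)$ is the set of all $r$ times continuously differentiable functions $h:[0,1]^d\to\mathbb R$ with $$\sum_{|\gamma|\le r}\|D^\gamma h\|_{L^\infty([0,1]^d)}+\max_{|\gamma|=r}\ \sup_{x\ne y}\frac{|D^\gamma h(x)-D^\gamma h(y)|}{\|x-y\|_\infty^\beta}\le 1 ,$$ where $\gamma\in\mathbb N_0^d$ runs over multi-indices and $x,y$ over $[0,1]^d$. A ReLU network of depth $D$ with input dimension $N_0=d$, output dimension $N_{D+1}=1$ and layer widths $N_0,\dots,N_{D+1}$ is a function $$\phi(x)=A_D\,\sigma\big(A_{D-1}\,\sigma(\cdots\sigma(A_0x+b_0)\cdots)+b_{D-1}\big),\qquad A_\ell\in\mathbb R^{N_{\ell+1}\times N_\ell},\ b_\ell\in\mathbb R^{N_{\ell+1}},$$ with $\sigma(t)=\max\{0,t\}$ applied componentwise; its width is $W=\max_\ell N_\ell$, and the norm of its parameters $\theta$ is $$\kappa(\theta)=\|A_D\|_F\prod_{\ell=0}^{D-1}\sqrt{\|A_\ell\|_F^2+\|b_\ell\|_2^2+1}.$$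 Let $\mathcal{NN}(W,D,K)$ be the set of all such functions of depth $D$ and width $W$ that have parameters $\theta$ with $\kappa(\theta)\le K$. Then there are constants $c_1,c_2>0$, depending only on $d$, $r$ and $\beta$, such that for every real $K\ge 1$, every integer $W\ge c_1K^{\frac{2d+\alpha}{d(D+1)+2}}$ and every $h$ in the unit ball of $\mathcal C^\alpha([0,1]^d)$ there is a network $\phi\in\mathcal{NN}(W,D,K)$ with $$\sup_{x\in[0,1]^d}|h(x)-\phi(x)|\le c_2\,K^{-\frac{2\alpha}{2+d(D+1)}} .$$ -/

import Mathlib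

/-- The closed unit cube `[0,1]^d`. -/
def unitCube (d : ℕ) : Set (Fin d → ℝ) := Set.Icc 0 1

/-- The list of directions `(e₁, …, e₁, e₂, …, e₂, …, e_d, …, e_d)` of a multi-index `γ`,
each `e_i` being repeated `γ i` times. -/
def multiIndexDirections {d : ℕ} (γ : Fin d → ℕ) : Fin (∑ i, γ i) → (Fin d → ℝ) :=
  fun j => Pi.single (finSigmaFinEquiv.symm j).1 1

/-- The partial derivative `D^γ h = ∂₁^{γ₁} ⋯ ∂_d^{γ_d} h` on the cube: the derivative of order
`|γ|` of `h` within the cube, evaluated at the directions of `γ`. It only depends on the values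
of `h` on the cube (one-sided derivatives at the boundary). -/
noncomputable def partialDerivCube {d : ℕ} (γ : Fin d → ℕ) (h : (Fin d → ℝ) → ℝ)
    (x : Fin d → ℝ) : ℝ :=
  iteratedFDerivWithin ℝ (∑ i, γ i) h (unitCube d) x (multiIndexDirections γ)

/-- The Hölder norm of order `r + β` on the cube, with values in `[0, ∞]`. The set
`Finset.piAntidiag Finset.univ m` consists of all multi-indices `γ` with `|γ| = m`, and the norm
on `Fin d → ℝ` is the maximum norm. -/
noncomputable def holderNorm (d r : ℕ) (β : ℝ) (h : (Fin d → ℝ) → ℝ) : ENNReal :=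
  (∑ m ∈ Finset.range (r + 1), ∑ γ ∈ Finset.piAntidiag (Finset.univ : Finset (Fin d)) m,
      ⨆ x ∈ unitCube d, ENNReal.ofReal |partialDerivCube γ h x|) +
    ⨆ γ ∈ Finset.piAntidiag (Finset.univ : Finset (Fin d)) r,
      ⨆ x ∈ unitCube d, ⨆ y ∈ unitCube d, ⨆ _ : x ≠ y,
        ENNReal.ofReal (|partialDerivCube γ h x - partialDerivCube γ h y| / ‖x - y‖ ^ β)

/-- The unit ball of the Hölder space of order `r + β` on the cube. Functions on the cube are
represented by functions on the whole space, of which only the values on the cube matter. -/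
def holderUnitBall (d r : ℕ) (β : ℝ) : Set ((Fin d → ℝ) → ℝ) :=
  {h | ContDiffOn ℝ r h (unitCube d) ∧ holderNorm d r β h ≤ 1}

/-- The squared Frobenius norm of a matrix. -/
def frobeniusSq {m n : ℕ} (A : Matrix (Fin m) (Fin n) ℝ) : ℝ := ∑ i, ∑ j, A i j ^ 2

/-- Parameters of a ReLU network with output dimension `k`. An element of `ReLUNet k D n` has
`D` hidden layers and input dimension `n`: it is a list `(A₀, b₀), …, (A_{D-1}, b_{D-1}), A_D` of
matrices and biases of matching sizes, with arbitrary hidden widths. -/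
inductive ReLUNet (k : ℕ) : ℕ → ℕ → Type
  | output {n : ℕ} (A : Matrix (Fin k) (Fin n) ℝ) : ReLUNet k 0 n
  | hidden {D n m : ℕ} (A : Matrix (Fin m) (Fin n) ℝ) (b : Fin m → ℝ) (rest : ReLUNet k D m) :
      ReLUNet k (D + 1) n

/-- The realized function
`x ↦ A_D σ(A_{D-1} σ(⋯ σ(A₀ x + b₀) ⋯) + b_{D-1})` with `σ(t) = max 0 t` componentwise. -/
def ReLUNet.realize {k : ℕ} : {D n : ℕ} → ReLUNet k D n → (Fin n → ℝ) → (Fin k → ℝ)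
  | _, _, .output A => fun x => A.mulVec x
  | _, _, .hidden A b rest => fun x => rest.realize (fun i => max 0 (A.mulVec x i + b i))

/-- The width: the maximum of all layer widths `N₀, …, N_{D+1}`, including the input and output
dimensions. -/
def ReLUNet.width {k : ℕ} : {D n : ℕ} → ReLUNet k D n → ℕ
  | _, n, .output _ => max n k
  | _, n, .hidden _ _ rest => max n rest.width

/-- The multiplicative norm
`κ(θ) = ‖A_D‖_F ∏_{ℓ<D} √(‖A_ℓ‖_F² + ‖b_ℓ‖₂² + 1)`. -/
noncomputable def ReLUNet.kappa {k : ℕ} : {D n : ℕ} → ReLUNet k D n → ℝ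
  | _, _, .output A => √(frobeniusSq A)
  | _, _, .hidden A b rest => √(frobeniusSq A + ∑ i, b i ^ 2 + 1) * rest.kappa

/-- The class `NN(W, D, K)` of functions `ℝ^d → ℝ^k` realized by ReLU networks of depth `D`,
maximal width `W` and multiplicative norm at most `K`. -/
def normConstrainedNN (d k W D : ℕ) (K : ℝ) : Set ((Fin d → ℝ) → (Fin k → ℝ)) :=
  {f | ∃ θ : ReLUNet k D d, θ.width = W ∧ θ.kappa ≤ K ∧ θ.realize = f}

/-! On a grid of mesh `1 / N`, products of hat functions form a partition of unity. Blending the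
Taylor polynomials of `h` at the grid points with it gives error of order `N ^ (-α)`
(`exists_local_polynomial`). Each summand is a bounded coefficient times a product of `d` hats and
at most `r` coordinates, hence of `2 ^ L ≥ d + r` numbers in `[0, 1]` after padding by ones. Two
layers compute all these factors, and a binary tree with two layers per level multiplies them, so
the depth is `2 + 2 * L`.

A product is a difference of squares, and a square is replaced by a sum of `M` hinges with error `1
/ M ^ 2`; `M ~ N ^ (α / 2)` matches the Taylor error. Product errors do not add up over all cells:
an approximate product with a zero factor is exactly zero, so at most `2 ^ d` cells act at each
point (`abs_sub_sum_blockFun_le`).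

The norm is controlled because `M` does not enter it: the factor `1 / M` in front of the hinges is
split evenly between two layers by homogeneity of the ReLU (`HiddenRep.mulApprox`). With `n ~ N ^ d`
factors in all, each of the `D + 1` matrices contributes `O(n)` to `κ ^ 2`, and the hat slopes
contribute `N ^ 2`. Hence `κ ^ 2` is of order at most `N ^ (2 + d * (D + 1))` with width of order `N
^ (d + α / 2)`, and `N ~ K ^ (2 / (2 + d * (D + 1)))` gives the theorem. -/

/-! ### Padding a network to a prescribed width. -/

theorem kappa_nonneg {k : ℕ} : ∀ {D n : ℕ} (θ : ReLUNet k D n), 0 ≤ θ.kappa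
  | _, _, .output A => by simp only [ReLUNet.kappa]; positivity
  | _, _, .hidden A b rest => by
      simp only [ReLUNet.kappa]; exact mul_nonneg (Real.sqrt_nonneg _) (kappa_nonneg rest)

theorem frobeniusSq_nonneg {m n : ℕ} (A : Matrix (Fin m) (Fin n) ℝ) : 0 ≤ frobeniusSq A := by
  unfold frobeniusSq; positivity

theorem sum_extend_zero {M : Type*} [AddCommMonoid M] {m W : ℕ} (hmW : m ≤ W) (f : Fin m → M) :
    ∑ j : Fin W, (if h : (j : ℕ) < m then f ⟨j, h⟩ else 0) = ∑ j, f j := by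
  obtain ⟨p, rfl⟩ := Nat.exists_eq_add_of_le hmW
  rw [Fin.sum_univ_add]
  simp

/-- Adding input coordinates that the network ignores. -/
theorem exists_extend_input {k : ℕ} {D m : ℕ} (θ : ReLUNet k D m) {W : ℕ} (hmW : m ≤ W) :
    ∃ θ' : ReLUNet k D W, (∀ y, θ'.realize y = θ.realize (fun j => y (Fin.castLE hmW j))) ∧
      θ'.width ≤ max W θ.width ∧ W ≤ θ'.width ∧ θ'.kappa = θ.kappa := by
  have key : ∀ {l : ℕ} (A : Matrix (Fin l) (Fin m) ℝ), ∃ A' : Matrix (Fin l) (Fin W) ℝ,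
      frobeniusSq A' = frobeniusSq A ∧
      ∀ y, A'.mulVec y = A.mulVec (fun j => y (Fin.castLE hmW j)) := by
    intro l A
    refine ⟨Matrix.of fun i j => if h : (j : ℕ) < m then A i ⟨j, h⟩ else 0, ?_, ?_⟩
    · unfold frobeniusSq
      refine Finset.sum_congr rfl fun i _ => ?_
      rw [← sum_extend_zero hmW]
      refine Finset.sum_congr rfl fun j _ => ?_
      by_cases h : (j : ℕ) < m <;> simp [h]
    · intro y
      ext i
      simp only [Matrix.mulVec, dotProduct]
      rw [← sum_extend_zero hmW (fun j => A i j * y (Fin.castLE hmW j))]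
      refine Finset.sum_congr rfl fun j _ => ?_
      by_cases h : (j : ℕ) < m <;> simp [h]
  cases θ with
  | output A =>
    obtain ⟨A', h1, h2⟩ := key A
    exact ⟨.output A', fun y => h2 y, by simp only [ReLUNet.width]; omega,
      by simp [ReLUNet.width],
      by simp [ReLUNet.kappa, h1]⟩
  | hidden A b rest =>
    obtain ⟨A', h1, h2⟩ := key A
    refine ⟨.hidden A' b rest, fun y => ?_, ?_, ?_, ?_⟩
    · simp only [ReLUNet.realize, h2]
    · simp only [ReLUNet.width]
      omega
    · simp [ReLUNet.width]
    · simp [ReLUNet.kappa, h1]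

/-- The class prescribes the width exactly. Since width is a maximum, it suffices to enlarge the
first hidden layer by zero rows that the next layer ignores; zero entries leave the norm unchanged.
-/
theorem exists_width_eq {k D n W : ℕ} (θ : ReLUNet k (D + 1) n) (hW : θ.width ≤ W) :
    ∃ θ' : ReLUNet k (D + 1) n, θ'.realize = θ.realize ∧ θ'.width = W ∧ θ'.kappa = θ.kappa := by
  cases θ with
  | @hidden _ _ m A b rest =>
    simp only [ReLUNet.width, max_le_iff] at hW
    have hm : m ≤ rest.width := by cases rest <;> simp [ReLUNet.width]
    have hmW : m ≤ W := hm.trans hW.2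
    obtain ⟨rest', h1, h2, h2', h3⟩ := exists_extend_input rest hmW
    refine ⟨.hidden (Matrix.of fun i j => if h : (i : ℕ) < m then A ⟨i, h⟩ j else 0)
      (fun i => if h : (i : ℕ) < m then b ⟨i, h⟩ else 0) rest', ?_, ?_, ?_⟩
    · funext x
      simp only [ReLUNet.realize, h1]
      congr 1
      funext j
      simp [Matrix.mulVec, dotProduct]
    · simp only [ReLUNet.width]
      have : rest'.width = W := le_antisymm (h2.trans (max_le le_rfl hW.2)) h2'
      omega
    · simp only [ReLUNet.kappa, h3]
      congr 3
      · congr 1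
        · unfold frobeniusSq
          rw [← sum_extend_zero hmW]
          refine Finset.sum_congr rfl fun i _ => ?_
          by_cases h : (i : ℕ) < m <;> simp [h]
        · rw [← sum_extend_zero hmW]
          refine Finset.sum_congr rfl fun i _ => ?_
          by_cases h : (i : ℕ) < m <;> simp [h]

/-! ### Composing layers while tracking the norm. -/

/-- The vector function `F` is computed by `D` hidden layers (including the final activation) of
widths at most `w`, the product of the squared layer norms being at most `B`. -/
def HiddenRep {d : ℕ} (D w : ℕ) (B : ℝ) {ι : Type} [Fintype ι]
    (F : (Fin d → ℝ) → ι → ℝ) : Prop :=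
  ∀ (E T n k : ℕ) (e : ι ≃ Fin n) (rest : ReLUNet k E n), T = E + D →
    ∃ θ : ReLUNet k T d, (∀ x, θ.realize x = rest.realize (fun j => F x (e.symm j))) ∧
      θ.width ≤ max w rest.width ∧ θ.kappa ^ 2 ≤ B * rest.kappa ^ 2

theorem kappa_hidden_sq {k D n m : ℕ} (A : Matrix (Fin m) (Fin n) ℝ) (b : Fin m → ℝ)
    (rest : ReLUNet k D m) :
    (ReLUNet.hidden A b rest).kappa ^ 2 =
      (frobeniusSq A + ∑ i, b i ^ 2 + 1) * rest.kappa ^ 2 := by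
  simp only [ReLUNet.kappa]
  rw [mul_pow, Real.sq_sqrt]
  have := frobeniusSq_nonneg A
  positivity

theorem HiddenRep.first {d w : ℕ} {κ : Type} [Fintype κ] (A : κ → Fin d → ℝ) (b : κ → ℝ)
    {S : ℝ} (hS : ∑ k, ∑ i, A k i ^ 2 + ∑ k, b k ^ 2 + 1 ≤ S) (hd : d ≤ w) :
    HiddenRep 1 w S (fun x k => max 0 (∑ i, A k i * x i + b k)) := by
  intro E T n k e rest hT
  subst hT
  refine ⟨.hidden (Matrix.of fun i j => A (e.symm i) j) (fun i => b (e.symm i)) rest, ?_, ?_, ?_⟩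
  · intro x
    simp only [ReLUNet.realize, Matrix.mulVec, dotProduct, Matrix.of_apply]
  · simp only [ReLUNet.width]
    exact max_le_max hd le_rfl
  · rw [kappa_hidden_sq]
    refine mul_le_mul_of_nonneg_right ?_ (sq_nonneg _)
    simp only [frobeniusSq, Matrix.of_apply]
    rw [Equiv.sum_comp e.symm (fun i => ∑ j, A i j ^ 2), Equiv.sum_comp e.symm (fun i => b i ^ 2)]
    exact hS

/-- A network is a list read from the input, so nothing can be appended directly at its output end.
`HiddenRep` therefore quantifies over all continuations `rest`, and the new layer is put in front of
`rest`. -/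
theorem HiddenRep.step {d D w : ℕ} {B : ℝ} {ι κ : Type} [Fintype ι] [Fintype κ]
    {F : (Fin d → ℝ) → ι → ℝ} (hF : HiddenRep D w B F) (hB : 0 ≤ B)
    (A : κ → ι → ℝ) (b : κ → ℝ) {S : ℝ}
    (hS : ∑ k, ∑ i, A k i ^ 2 + ∑ k, b k ^ 2 + 1 ≤ S) (hw : Fintype.card ι ≤ w) :
    HiddenRep (D + 1) w (B * S) (fun x k => max 0 (∑ i, A k i * F x i + b k)) := by
  intro E T n k e rest hT
  have e' := Fintype.equivFin ι
  obtain ⟨θ, h1, h2, h3⟩ := hF (E + 1) T _ k e'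
    (.hidden (Matrix.of fun i j => A (e.symm i) (e'.symm j)) (fun i => b (e.symm i)) rest) (by omega)
  refine ⟨θ, ?_, ?_, ?_⟩
  · intro x
    rw [h1]
    simp only [ReLUNet.realize, Matrix.mulVec, dotProduct, Matrix.of_apply]
    congr 1
    funext j
    rw [Equiv.sum_comp e'.symm (fun i => A (e.symm j) i * F x i)]
  · simp only [ReLUNet.width] at h2
    omega
  · rw [kappa_hidden_sq] at h3
    refine h3.trans ?_
    rw [mul_assoc]
    refine mul_le_mul_of_nonneg_left (mul_le_mul_of_nonneg_right ?_ (sq_nonneg _)) hB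
    simp only [frobeniusSq, Matrix.of_apply]
    rw [Equiv.sum_comp e.symm (fun i => ∑ j, A i (e'.symm j) ^ 2),
      Equiv.sum_comp e.symm (fun i => b i ^ 2)]
    simp_rw [fun k => Equiv.sum_comp e'.symm (fun i => A k i ^ 2)]
    exact hS

theorem HiddenRep.output {d D w : ℕ} {B : ℝ} {ι : Type} [Fintype ι]
    {F : (Fin d → ℝ) → ι → ℝ} (hF : HiddenRep D w B F)
    (c : ι → ℝ) (hw : Fintype.card ι ≤ w) (hw1 : 1 ≤ w) :
    ∃ θ : ReLUNet 1 D d, (∀ x, θ.realize x 0 = ∑ i, c i * F x i) ∧ θ.width ≤ w ∧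
      θ.kappa ^ 2 ≤ B * ∑ i, c i ^ 2 := by
  have e' := Fintype.equivFin ι
  obtain ⟨θ, h1, h2, h3⟩ := hF 0 D _ 1 e' (.output (Matrix.of fun _ j => c (e'.symm j))) (by omega)
  refine ⟨θ, ?_, ?_, ?_⟩
  · intro x
    rw [h1]
    simp only [ReLUNet.realize, Matrix.mulVec, dotProduct, Matrix.of_apply]
    rw [Equiv.sum_comp e'.symm (fun i => c i * F x i)]
  · simp only [ReLUNet.width] at h2
    omega
  · refine h3.trans (le_of_eq ?_)
    simp only [ReLUNet.kappa]
    rw [Real.sq_sqrt (frobeniusSq_nonneg _)]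
    simp only [frobeniusSq, Matrix.of_apply, Finset.univ_unique, Finset.sum_singleton]
    rw [Equiv.sum_comp e'.symm (fun i => c i ^ 2)]

theorem HiddenRep.congr {d D w : ℕ} {B B' : ℝ} {ι : Type} [Fintype ι]
    {F G : (Fin d → ℝ) → ι → ℝ} (hF : HiddenRep D w B F) (h : ∀ x i, F x i = G x i)
    (hB : B ≤ B') : HiddenRep D w B' G := by
  have : F = G := by funext x i; exact h x i
  subst this
  intro E T n k e rest hT
  obtain ⟨θ, h1, h2, h3⟩ := hF E T n k e rest hT
  exact ⟨θ, h1, h2, h3.trans (mul_le_mul_of_nonneg_right hB (sq_nonneg _))⟩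

theorem HiddenRep.reindex {d D w : ℕ} {B : ℝ} {ι κ : Type} [Fintype ι] [Fintype κ]
    {F : (Fin d → ℝ) → ι → ℝ} (hF : HiddenRep D w B F) (f : κ ≃ ι) :
    HiddenRep D w B (fun x k => F x (f k)) := by
  intro E T n k e rest hT
  obtain ⟨θ, h1, h2, h3⟩ := hF E T n k (f.symm.trans e) rest hT
  exact ⟨θ, fun x => by rw [h1]; rfl, h2, h3⟩

/-! ### Piecewise linear squares and approximate products. -/

/-- The piecewise linear approximation of `t ↦ max 0 t ^ 2` on `[0, 1]` with kinks at the
midpoints of a uniform grid of mesh `1 / M`. -/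
noncomputable def squareApprox (M : ℕ) (t : ℝ) : ℝ :=
  2 / M * ∑ i ∈ Finset.range M, max 0 (t - (i + 1 / 2) / M)

theorem squareApprox_of_nonpos (M : ℕ) {t : ℝ} (ht : t ≤ 0) : squareApprox M t = 0 := by
  unfold squareApprox
  rw [Finset.sum_eq_zero, mul_zero]
  intro i _
  have : (0 : ℝ) ≤ (i + 1 / 2) / M := by positivity
  exact max_eq_left (by linarith)

theorem squareApprox_mono (M : ℕ) : Monotone (squareApprox M) := by
  intro s t hst
  unfold squareApprox
  gcongr

theorem squareApprox_nonneg (M : ℕ) (t : ℝ) : 0 ≤ squareApprox M t := by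
  unfold squareApprox
  exact mul_nonneg (by positivity) (Finset.sum_nonneg fun i _ => le_max_left _ _)

/-- The right side is the tangent to `t ^ 2` at `n`. Tangents at consecutive integers meet at the
midpoint, which is why the kinks lie there; the hinge sum is exact at the integers `0, …, n`. -/
theorem sum_hinge_of_le (n : ℕ) {t : ℝ} (ht : (n : ℝ) ≤ t) :
    ∑ i ∈ Finset.range n, 2 * max 0 (t - ((i : ℝ) + 1 / 2)) = 2 * t * n - n ^ 2 := by
  induction n with
  | zero => simp
  | succ n ih =>
    push_cast at ht
    rw [Finset.sum_range_succ, ih (by linarith), max_eq_right (by linarith)]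
    push_cast
    ring

theorem abs_sum_hinge_sub_sq_le (n : ℕ) {t : ℝ} (h0 : 0 ≤ t) (ht : t ≤ n) :
    |∑ i ∈ Finset.range n, 2 * max 0 (t - ((i : ℝ) + 1 / 2)) - t ^ 2| ≤ 1 := by
  induction n with
  | zero =>
    have : t = 0 := le_antisymm (by simpa using ht) h0
    simp [this]
  | succ n ih =>
    rw [Finset.sum_range_succ]
    push_cast at ht
    rcases le_total t n with h | h
    · rw [max_eq_left (by linarith), mul_zero, add_zero]
      exact ih h
    · rw [sum_hinge_of_le n h]
      rw [abs_le]
      rcases le_total (t - ((n : ℝ) + 1 / 2)) 0 with h' | h'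
      · rw [max_eq_left h']
        constructor <;> nlinarith
      · rw [max_eq_right h']
        constructor <;> nlinarith

theorem squareApprox_eq {M : ℕ} (hM : 1 ≤ M) (t : ℝ) :
    squareApprox M t =
      (∑ i ∈ Finset.range M, 2 * max 0 (M * t - ((i : ℝ) + 1 / 2))) / (M : ℝ) ^ 2 := by
  have hM' : (0 : ℝ) < M := by exact_mod_cast hM
  unfold squareApprox
  rw [Finset.mul_sum, Finset.sum_div]
  refine Finset.sum_congr rfl fun i _ => ?_
  have : (M : ℝ) * t - (i + 1 / 2) = M * (t - (i + 1 / 2) / M) := by field_simp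
  rw [this, ← mul_zero (M : ℝ), ← mul_max_of_nonneg _ _ hM'.le, mul_zero]
  field_simp

theorem abs_squareApprox_sub_sq_le {M : ℕ} (hM : 1 ≤ M) {t : ℝ} (h0 : 0 ≤ t) (h1 : t ≤ 1) :
    |squareApprox M t - t ^ 2| ≤ 1 / (M : ℝ) ^ 2 := by
  have hM' : (0 : ℝ) < M := by exact_mod_cast hM
  have h := abs_sum_hinge_sub_sq_le M (t := M * t) (by positivity) (by nlinarith)
  rw [squareApprox_eq hM]
  have e : t ^ 2 = (M * t) ^ 2 / (M : ℝ) ^ 2 := by field_simp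
  rw [e, ← sub_div, abs_div, abs_of_pos (show (0 : ℝ) < (M : ℝ) ^ 2 by positivity)]
  gcongr

theorem squareApprox_le_one {M : ℕ} (hM : 1 ≤ M) {t : ℝ} (h1 : t ≤ 1) :
    squareApprox M t ≤ 1 := by
  have hM' : (0 : ℝ) < M := by exact_mod_cast hM
  refine (squareApprox_mono M h1).trans (le_of_eq ?_)
  rw [squareApprox_eq hM, sum_hinge_of_le M (by simp)]
  field_simp
  ring

/-- The product `a * b = ((a + b) / 2) ^ 2 - ((a - b) / 2) ^ 2` with approximate squares. -/
noncomputable def mulApprox (M : ℕ) (a b : ℝ) : ℝ :=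
  max 0 (squareApprox M ((a + b) / 2) - squareApprox M ((a - b) / 2)
    - squareApprox M ((b - a) / 2))

theorem mulApprox_nonneg (M : ℕ) (a b : ℝ) : 0 ≤ mulApprox M a b := le_max_left _ _

theorem mulApprox_le_one {M : ℕ} (hM : 1 ≤ M) {a b : ℝ} (ha : a ≤ 1) (hb : b ≤ 1) :
    mulApprox M a b ≤ 1 := by
  have h1 := squareApprox_le_one hM (t := (a + b) / 2) (by linarith)
  have h2 := squareApprox_nonneg M ((a - b) / 2)
  have h3 := squareApprox_nonneg M ((b - a) / 2)
  exact max_le zero_le_one (by linarith)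

/-- The two remaining squares are both taken at `b / 2` and cancel exactly. This exactness localizes
the blocks later. -/
theorem mulApprox_zero_left (M : ℕ) {b : ℝ} (hb : 0 ≤ b) : mulApprox M 0 b = 0 := by
  unfold mulApprox
  rw [squareApprox_of_nonpos M (t := (0 - b) / 2) (by linarith)]
  simp

theorem mulApprox_zero_right (M : ℕ) {a : ℝ} (ha : 0 ≤ a) : mulApprox M a 0 = 0 := by
  unfold mulApprox
  rw [squareApprox_of_nonpos M (t := (0 - a) / 2) (by linarith)]
  simp

/-- Of the two subtracted squares one has a nonpositive argument and vanishes, so only two squaring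
errors remain. Truncation at zero is harmless because `a * b ≥ 0`. -/
theorem abs_mulApprox_sub_mul_le {M : ℕ} (hM : 1 ≤ M) {a b : ℝ} (ha0 : 0 ≤ a) (ha : a ≤ 1)
    (hb0 : 0 ≤ b) (hb : b ≤ 1) : |mulApprox M a b - a * b| ≤ 2 / (M : ℝ) ^ 2 := by
  have key : |squareApprox M ((a + b) / 2) - squareApprox M ((a - b) / 2)
      - squareApprox M ((b - a) / 2) - a * b| ≤ 2 / (M : ℝ) ^ 2 := by
    have h1 := abs_squareApprox_sub_sq_le hM (t := (a + b) / 2) (by linarith) (by linarith)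
    have e : 2 / (M : ℝ) ^ 2 = 1 / (M : ℝ) ^ 2 + 1 / (M : ℝ) ^ 2 := by ring
    rw [e]
    rw [abs_le] at h1 ⊢
    rcases le_total a b with hab | hab
    · have h2 := abs_squareApprox_sub_sq_le hM (t := (b - a) / 2) (by linarith) (by linarith)
      rw [squareApprox_of_nonpos M (t := (a - b) / 2) (by linarith)]
      rw [abs_le] at h2
      constructor <;> nlinarith
    · have h2 := abs_squareApprox_sub_sq_le hM (t := (a - b) / 2) (by linarith) (by linarith)
      rw [squareApprox_of_nonpos M (t := (b - a) / 2) (by linarith)]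
      rw [abs_le] at h2
      constructor <;> nlinarith
  have hab : a * b = max (a * b) 0 := (max_eq_left (mul_nonneg ha0 hb0)).symm
  unfold mulApprox
  rw [max_comm 0, hab]
  exact (abs_max_sub_max_le_abs _ _ _).trans key

/-! ### Binary product trees. -/

/-- Approximate product of `2 ^ k` numbers along a binary tree. -/
noncomputable def treeProd (M : ℕ) : (k : ℕ) → ((Fin k → Bool) → ℝ) → ℝ
  | 0, v => v default
  | k + 1, v => treeProd M k fun l =>
      mulApprox M (v (Fin.cons false l)) (v (Fin.cons true l))

theorem treeProd_eq_zero {M : ℕ} (hM : 1 ≤ M) : ∀ (k : ℕ) (v : (Fin k → Bool) → ℝ),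
    (∀ l, 0 ≤ v l) → (∃ l, v l = 0) → treeProd M k v = 0
  | 0, v, _, ⟨l, hl⟩ => by
      simp only [treeProd]
      rw [← hl]
      congr 1
      exact Subsingleton.elim _ _
  | k + 1, v, hv, ⟨l, hl⟩ => by
      simp only [treeProd]
      refine treeProd_eq_zero hM k _ (fun l => mulApprox_nonneg _ _ _) ⟨Fin.tail l, ?_⟩
      have e : l = Fin.cons (l 0) (Fin.tail l) := (Fin.cons_self_tail l).symm
      cases h0 : l 0
      · rw [h0] at e
        rw [← e, hl, mulApprox_zero_left M (hv _)]
      · rw [h0] at e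
        rw [← e, hl, mulApprox_zero_right M (hv _)]

theorem abs_prod_sub_prod_le {ι : Type*} (s : Finset ι) (f g : ι → ℝ) {δ : ℝ}
    (hf : ∀ i, 0 ≤ f i ∧ f i ≤ 1) (hg : ∀ i, 0 ≤ g i ∧ g i ≤ 1) (h : ∀ i, |f i - g i| ≤ δ) :
    |∏ i ∈ s, f i - ∏ i ∈ s, g i| ≤ s.card * δ := by
  classical
  induction s using Finset.induction_on with
  | empty => simp
  | insert a s ha ih =>
    rw [Finset.prod_insert ha, Finset.prod_insert ha, Finset.card_insert_of_notMem ha]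
    have e : f a * ∏ i ∈ s, f i - g a * ∏ i ∈ s, g i =
      f a * (∏ i ∈ s, f i - ∏ i ∈ s, g i) + (f a - g a) * ∏ i ∈ s, g i := by ring
    rw [e]
    refine (abs_add_le _ _).trans ?_
    rw [abs_mul, abs_mul, abs_of_nonneg (hf a).1,
      abs_of_nonneg (Finset.prod_nonneg fun i _ => (hg i).1)]
    have h1 : ∏ i ∈ s, g i ≤ 1 := Finset.prod_le_one (fun i _ => (hg i).1) fun i _ => (hg i).2
    have h2 : f a * |∏ i ∈ s, f i - ∏ i ∈ s, g i| ≤ 1 * (s.card * δ) :=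
      mul_le_mul (hf a).2 ih (abs_nonneg _) zero_le_one
    have h3 : |f a - g a| * ∏ i ∈ s, g i ≤ δ * 1 :=
      mul_le_mul (h a) h1 (Finset.prod_nonneg fun i _ => (hg i).1) ((abs_nonneg _).trans (h a))
    push_cast
    linarith

theorem prod_cons_bool {k : ℕ} (v : (Fin (k + 1) → Bool) → ℝ) :
    ∏ l, v l = ∏ l : Fin k → Bool, v (Fin.cons false l) * v (Fin.cons true l) := by
  rw [← Equiv.prod_comp (Fin.consEquiv (fun _ : Fin (k + 1) => Bool)) v,
    Fintype.prod_prod_type, Finset.prod_mul_distrib]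
  simp [Fin.consEquiv, mul_comm]

/-- All intermediate values stay in `[0, 1]`, so errors add without amplification: the `2 ^ k`
products at the leaves and the remaining tree contribute `2 ^ k` units each. -/
theorem abs_treeProd_sub_prod_le {M : ℕ} (hM : 1 ≤ M) : ∀ (k : ℕ) (v : (Fin k → Bool) → ℝ),
    (∀ l, 0 ≤ v l ∧ v l ≤ 1) → |treeProd M k v - ∏ l, v l| ≤ 2 ^ k * (2 / (M : ℝ) ^ 2)
  | 0, v, _ => by
      have : |treeProd M 0 v - ∏ l, v l| = 0 := by
        rw [Fintype.prod_unique, abs_eq_zero, sub_eq_zero]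
        simp only [treeProd]
        congr 1
        exact Subsingleton.elim _ _
      rw [this]
      positivity
  | k + 1, v, hv => by
      simp only [treeProd]
      have hm : ∀ l : Fin k → Bool,
          0 ≤ mulApprox M (v (Fin.cons false l)) (v (Fin.cons true l)) ∧
          mulApprox M (v (Fin.cons false l)) (v (Fin.cons true l)) ≤ 1 := fun l =>
        ⟨mulApprox_nonneg _ _ _, mulApprox_le_one hM (hv _).2 (hv _).2⟩
      have h1 := abs_treeProd_sub_prod_le hM k _ hm
      have h2 := abs_prod_sub_prod_le Finset.univ
        (fun l : Fin k → Bool => mulApprox M (v (Fin.cons false l)) (v (Fin.cons true l)))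
        (fun l => v (Fin.cons false l) * v (Fin.cons true l)) (δ := 2 / (M : ℝ) ^ 2) hm
        (fun l => ⟨mul_nonneg (hv _).1 (hv _).1, mul_le_one₀ (hv _).2 (hv _).1 (hv _).2⟩)
        (fun l => abs_mulApprox_sub_mul_le hM (hv _).1 (hv _).2 (hv _).1 (hv _).2)
      have hc : ((Finset.univ : Finset (Fin k → Bool)).card : ℝ) = 2 ^ k := by simp
      rw [hc] at h2
      rw [prod_cons_bool]
      refine (abs_sub_le _ _ _).trans ((add_le_add h1 h2).trans (le_of_eq ?_))
      ring

/-! ### Networks for products. -/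

theorem HiddenRep.mulApprox {d D w M : ℕ} (hM : 1 ≤ M) {B : ℝ} {ι ι' : Type} [Fintype ι]
    [Fintype ι'] {F : (Fin d → ℝ) → ι' → ℝ} (hF : HiddenRep D w B F) (hB : 0 ≤ B)
    (a b : ι → ι') (hw : Fintype.card ι' ≤ w) (hw' : 3 * M * Fintype.card ι ≤ w) :
    HiddenRep (D + 2) w (B * (6 * Fintype.card ι + 1) * (12 * Fintype.card ι + 1))
      (fun x i => mulApprox M (F x (a i)) (F x (b i))) := by
  classical
  have hM' : (0 : ℝ) < M := by exact_mod_cast hM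
  -- The weight `2 / M` of the hinges is split as `q⁻¹ * (2 * q⁻¹)` over the two layers. Per
  -- product, `3 * M` neurons then cost at most `3 + 3` (weights and biases) in the first layer and
  -- `3 * M * (4 / M) = 12` in the second, independently of `M`.
  set q : ℝ := √(M : ℝ) with hq
  have hq0 : 0 < q := Real.sqrt_pos.2 hM'
  have hqM : q ^ 2 = M := Real.sq_sqrt hM'.le
  let α : Fin 3 → ℝ := ![1 / 2, 1 / 2, -1 / 2]
  let β : Fin 3 → ℝ := ![1 / 2, -1 / 2, 1 / 2]
  let γ : Fin 3 → ℝ := ![1, -1, -1]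
  have hα : ∀ s, α s ^ 2 = 1 / 4 := by intro s; fin_cases s <;> norm_num [α]
  have hβ : ∀ s, β s ^ 2 = 1 / 4 := by intro s; fin_cases s <;> norm_num [β]
  have hγ : ∀ s, γ s ^ 2 = 1 := by intro s; fin_cases s <;> norm_num [γ]
  let A : ι × Fin 3 × Fin M → ι' → ℝ := fun k l =>
    q⁻¹ * ((if l = a k.1 then α k.2.1 else 0) + (if l = b k.1 then β k.2.1 else 0))
  let bi : ι × Fin 3 × Fin M → ℝ := fun k => -(q⁻¹ * (((k.2.2 : ℕ) + 1 / 2) / M))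
  let A' : ι → ι × Fin 3 × Fin M → ℝ := fun i k => if k.1 = i then 2 * q⁻¹ * γ k.2.1 else 0
  have hcard : (Fintype.card (ι × Fin 3 × Fin M) : ℝ) = 3 * M * Fintype.card ι := by
    simp; ring
  have hA : ∀ k, ∑ l, A k l ^ 2 ≤ 1 / M := by
    intro k
    -- If `a` and `b` pick the same input, the two weights add up; `(α + β) ^ 2 ≤ 2 * α ^ 2 + 2 * β
    -- ^ 2` covers this case too.
    have : ∀ l, A k l ^ 2 ≤
        1 / M * ((if l = a k.1 then 1 / 2 else 0) + (if l = b k.1 then 1 / 2 else 0)) := by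
      intro l
      simp only [A]
      rw [mul_pow, inv_pow, hqM, ← one_div]
      refine mul_le_mul_of_nonneg_left ?_ (by positivity)
      have h1 := hα k.2.1
      have h2 := hβ k.2.1
      split_ifs <;> nlinarith [sq_nonneg (α k.2.1 - β k.2.1)]
    refine (Finset.sum_le_sum fun l _ => this l).trans (le_of_eq ?_)
    rw [← Finset.mul_sum, Finset.sum_add_distrib]
    simp only [Finset.sum_ite_eq', Finset.mem_univ, if_true]
    ring
  have hb : ∀ k, bi k ^ 2 ≤ 1 / M := by
    intro k
    simp only [bi]
    rw [neg_sq, mul_pow, inv_pow, hqM, ← one_div]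
    refine mul_le_of_le_one_right (by positivity) ?_
    have h1 : ((k.2.2 : ℕ) : ℝ) + 1 ≤ M := by exact_mod_cast k.2.2.2
    have h2 : (((k.2.2 : ℕ) : ℝ) + 1 / 2) / M ≤ 1 := (div_le_one hM').2 (by linarith)
    exact pow_le_one₀ (by positivity) h2
  have hS1 : ∑ k, ∑ l, A k l ^ 2 + ∑ k, bi k ^ 2 + 1 ≤ 6 * Fintype.card ι + 1 := by
    have h1 : ∑ k, ∑ l, A k l ^ 2 ≤ ∑ _k : ι × Fin 3 × Fin M, 1 / (M : ℝ) :=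
      Finset.sum_le_sum fun k _ => hA k
    have h2 : ∑ k, bi k ^ 2 ≤ ∑ _k : ι × Fin 3 × Fin M, 1 / (M : ℝ) :=
      Finset.sum_le_sum fun k _ => hb k
    rw [Finset.sum_const, Finset.card_univ, nsmul_eq_mul, hcard] at h1 h2
    have e : 3 * (M : ℝ) * Fintype.card ι * (1 / M) = 3 * Fintype.card ι := by field_simp
    rw [e] at h1 h2
    linarith
  have hS2 : ∑ i, ∑ k, A' i k ^ 2 + ∑ _i : ι, (0 : ℝ) ^ 2 + 1 ≤ 12 * Fintype.card ι + 1 := by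
    have : ∀ i, ∑ k, A' i k ^ 2 = 12 := by
      intro i
      rw [Fintype.sum_prod_type]
      have : ∀ i', ∑ y : Fin 3 × Fin M, A' i (i', y) ^ 2 = if i' = i then 12 else 0 := by
        intro i'
        simp only [A']
        split_ifs with h
        · simp only [mul_pow, hγ, inv_pow, hqM]
          simp
          field_simp
          norm_num
        · simp
      simp [this]
    simp [this]
    linarith
  have hw3 : Fintype.card (ι × Fin 3 × Fin M) ≤ w := by
    refine le_trans (le_of_eq ?_) hw'
    simp; ring
  refine ((hF.step hB A bi hS1 hw).step (by positivity) A' (fun _ => 0) hS2 hw3).congr ?_ le_rfl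
  intro x i
  have hinner : ∀ k, ∑ l, A k l * F x l + bi k =
      q⁻¹ * (α k.2.1 * F x (a k.1) + β k.2.1 * F x (b k.1) - ((k.2.2 : ℕ) + 1 / 2) / M) := by
    intro k
    simp only [A, bi, mul_assoc, ← Finset.mul_sum, add_mul, Finset.sum_add_distrib, ite_mul,
      zero_mul, Finset.sum_ite_eq', Finset.mem_univ, if_true]
    ring
  have hmax : ∀ t, max 0 (q⁻¹ * t) = q⁻¹ * max 0 t := by
    intro t
    rw [mul_max_of_nonneg _ _ (by positivity), mul_zero]
  unfold _root_.mulApprox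
  rw [add_zero]
  congr 1
  simp only [hinner, hmax]
  rw [Fintype.sum_prod_type]
  have hsum : ∀ i', ∑ y : Fin 3 × Fin M, A' i (i', y) *
      (q⁻¹ * max 0 (α y.1 * F x (a i') + β y.1 * F x (b i') - ((y.2 : ℕ) + 1 / 2) / M)) =
      if i' = i then ∑ s, γ s * squareApprox M (α s * F x (a i) + β s * F x (b i)) else 0 := by
    intro i'
    simp only [A']
    split_ifs with h
    · subst h
      rw [Fintype.sum_prod_type]
      refine Finset.sum_congr rfl fun s _ => ?_
      unfold squareApprox
      rw [← Fin.sum_univ_eq_sum_range (fun j => max 0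
        (α s * F x (a i') + β s * F x (b i') - ((j : ℝ) + 1 / 2) / M)), Finset.mul_sum,
        Finset.mul_sum]
      refine Finset.sum_congr rfl fun j _ => ?_
      rw [← hqM]
      field_simp
    · simp
  rw [Finset.sum_congr rfl fun i' _ => hsum i']
  simp only [Finset.sum_ite_eq', Finset.mem_univ, if_true, Fin.sum_univ_three, α, β, γ]
  simp only [Matrix.cons_val_zero, Matrix.cons_val_one, Matrix.cons_val]
  rw [show 1 / 2 * F x (a i) + 1 / 2 * F x (b i) = (F x (a i) + F x (b i)) / 2 by ring,
    show 1 / 2 * F x (a i) + -1 / 2 * F x (b i) = (F x (a i) - F x (b i)) / 2 by ring,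
    show -1 / 2 * F x (a i) + 1 / 2 * F x (b i) = (F x (b i) - F x (a i)) / 2 by ring]
  ring

/-- The first bit of the leaf label is consumed by one multiplication level, and the rest of the
tree by induction. A single `n` bounds the number of nodes at every level, so each of the `2 * k`
layers costs at most `13 * n`. -/
theorem HiddenRep.treeProd {d w M n : ℕ} (hM : 1 ≤ M) {ι : Type} [Fintype ι] :
    ∀ (k : ℕ) {D : ℕ} {B : ℝ} {F : (Fin d → ℝ) → ι × (Fin k → Bool) → ℝ},
    HiddenRep D w B F → 0 ≤ B → 1 ≤ n → Fintype.card ι * 2 ^ k ≤ n → 3 * M * n ≤ w →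
    HiddenRep (D + 2 * k) w (B * (13 * n) ^ (2 * k))
      (fun x i => _root_.treeProd M k (fun l => F x (i, l)))
  | 0, D, B, F, hF, _, _, _, _ => by
      refine (hF.reindex (Equiv.prodUnique ι (Fin 0 → Bool)).symm).congr ?_ (by simp)
      intro x i
      simp only [_root_.treeProd, Equiv.prodUnique_symm_apply]
      exact congrArg (fun l => F x (i, l)) (Subsingleton.elim _ _)
  | k + 1, D, B, F, hF, hB, hn, hk, hw => by
      have hk' : Fintype.card ι * 2 ^ k ≤ n := by
        refine le_trans (Nat.mul_le_mul_left _ ?_) hk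
        exact Nat.pow_le_pow_right (by norm_num) (Nat.le_succ k)
      have hMn : n ≤ 3 * M * n := Nat.le_mul_of_pos_left _ (by omega)
      have h := hF.mulApprox hM hB
        (fun y : ι × (Fin k → Bool) => (y.1, (Fin.cons false y.2 : Fin (k + 1) → Bool)))
        (fun y : ι × (Fin k → Bool) => (y.1, (Fin.cons true y.2 : Fin (k + 1) → Bool)))
        (by simpa using hk.trans (hMn.trans hw))
        (le_trans (Nat.mul_le_mul_left _ (by simpa using hk')) hw)
      have h' := HiddenRep.treeProd hM k h (by positivity) hn hk' hw
      rw [show D + 2 + 2 * k = D + 2 * (k + 1) by ring] at h'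
      refine h'.congr (fun x i => rfl) ?_
      have hc : (Fintype.card (ι × (Fin k → Bool)) : ℝ) ≤ n := by
        exact_mod_cast (by simpa using hk')
      have hn' : (1 : ℝ) ≤ n := by exact_mod_cast hn
      have h1 : (6 * (Fintype.card (ι × (Fin k → Bool)) : ℝ) + 1) ≤ 13 * n := by linarith
      have h2 : (12 * (Fintype.card (ι × (Fin k → Bool)) : ℝ) + 1) ≤ 13 * n := by linarith
      rw [show 2 * (k + 1) = 1 + 1 + 2 * k by ring, pow_add (13 * (n : ℝ)) (1 + 1),
        ← mul_assoc, pow_add, pow_one, ← mul_assoc]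
      refine mul_le_mul_of_nonneg_right ?_ (by positivity)
      exact mul_le_mul (mul_le_mul_of_nonneg_left h1 hB) h2 (by positivity) (by positivity)

/-! ### Symmetry of iterated derivatives within a set. -/

section Symmetry

variable {E F : Type*} [NormedAddCommGroup E] [NormedSpace ℝ E] [NormedAddCommGroup F]
  [NormedSpace ℝ F]

theorem iteratedFDerivWithin_succ_apply_eq {s : Set E} {f : E → F} {n : ℕ}
    (hf : ContDiffOn ℝ ((n + 1 : ℕ) : WithTop ℕ∞) f s) (hs : UniqueDiffOn ℝ s) {x : E}
    (hx : x ∈ s) (v : Fin (n + 1) → E) :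
    iteratedFDerivWithin ℝ (n + 1) f s x v =
      fderivWithin ℝ (fun y => iteratedFDerivWithin ℝ n f s y (Fin.tail v)) s x (v 0) := by
  rw [iteratedFDerivWithin_succ_apply_left]
  exact (fderivWithin_continuousMultilinear_apply_const_apply (hs x hx)
    (hf.differentiableOn_iteratedFDerivWithin (by exact_mod_cast Nat.lt_succ_self n) hs x hx)
    _ _).symm

/-- A swap of the two outermost directions is symmetry of the second derivative of the function
obtained by fixing the others. Any other adjacent swap leaves the outermost direction alone and
follows by differentiating the lower order identity. -/
theorem iteratedFDerivWithin_comp_swap {s : Set E} {f : E → F} (hs : UniqueDiffOn ℝ s)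
    (hs' : s ⊆ closure (interior s)) : ∀ {n : ℕ},
    ContDiffOn ℝ ((n + 1 : ℕ) : WithTop ℕ∞) f s → ∀ (i : Fin n) {x : E}, x ∈ s →
    ∀ v : Fin (n + 1) → E,
    iteratedFDerivWithin ℝ (n + 1) f s x (v ∘ Equiv.swap i.castSucc i.succ) =
      iteratedFDerivWithin ℝ (n + 1) f s x v
  | 0, _, i, _, _, _ => i.elim0
  | n + 1, hf, i, x, hx, v => by
    have hf' : ContDiffOn ℝ ((n + 1 : ℕ) : WithTop ℕ∞) f s :=
      hf.of_le (by exact_mod_cast Nat.le_succ _)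
    rcases Fin.eq_zero_or_eq_succ i with rfl | ⟨j, rfl⟩
    · set u : Fin n → E := Fin.tail (Fin.tail v) with hu
      set g : E → F := fun y => iteratedFDerivWithin ℝ n f s y u with hg
      have hgc : ContDiffWithinAt ℝ 2 g s x := by
        have h1 : ContDiffWithinAt ℝ 2 (iteratedFDerivWithin ℝ n f s) s x :=
          (hf x hx).iteratedFDerivWithin_right hs
            (by norm_cast; omega) hx
        exact (ContinuousMultilinearMap.apply ℝ (fun _ : Fin n => E) F u).contDiff.contDiffAt
          |>.comp_contDiffWithinAt x h1
      have hsym := hgc.isSymmSndFDerivWithinAt (by simp) hs (hs' hx) hx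
      have hd : DifferentiableWithinAt ℝ (fderivWithin ℝ g s) s x :=
        (hgc.fderivWithin_right (m := 1) hs le_rfl hx).differentiableWithinAt one_ne_zero
      have key : ∀ w : Fin (n + 2) → E, Fin.tail (Fin.tail w) = u →
          iteratedFDerivWithin ℝ (n + 2) f s x w =
            fderivWithin ℝ (fderivWithin ℝ g s) s x (w 0) (w 1) := by
        intro w hw
        rw [iteratedFDerivWithin_succ_apply_eq hf hs hx]
        have : ∀ y ∈ s, iteratedFDerivWithin ℝ (n + 1) f s y (Fin.tail w) =
            fderivWithin ℝ g s y (w 1) := by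
          intro y hy
          rw [iteratedFDerivWithin_succ_apply_eq hf' hs hy, hw]
          rfl
        rw [fderivWithin_congr this (this x hx)]
        rw [fderivWithin_clm_apply (hs x hx) hd (differentiableWithinAt_const _)]
        simp
      rw [key v rfl, key _ ?_]
      · simpa using hsym.eq (v 1) (v 0)
      · funext j
        simp only [hu, Fin.tail, Function.comp]
        congr 1
    · rw [iteratedFDerivWithin_succ_apply_eq hf hs hx, iteratedFDerivWithin_succ_apply_eq hf hs hx]
      have h0 : (v ∘ Equiv.swap (Fin.succ j).castSucc (Fin.succ j).succ) 0 = v 0 := by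
        simp only [Function.comp]
        congr 1
      have ht : Fin.tail (v ∘ Equiv.swap (Fin.succ j).castSucc (Fin.succ j).succ) =
          Fin.tail v ∘ Equiv.swap j.castSucc j.succ := by
        funext k
        simp only [Fin.tail, Function.comp]
        congr 1
        rw [Fin.castSucc_succ]
        exact ((Fin.succ_injective _).swap_apply _ _ _).symm ▸ rfl
      rw [h0, ht]
      have : ∀ y ∈ s, iteratedFDerivWithin ℝ (n + 1) f s y
          (Fin.tail v ∘ Equiv.swap j.castSucc j.succ) =
          iteratedFDerivWithin ℝ (n + 1) f s y (Fin.tail v) := fun y hy =>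
        iteratedFDerivWithin_comp_swap hs hs' hf' j hy _
      rw [fderivWithin_congr this (this x hx)]

/-- The derivatives of a `C^n` function within a set that is contained in the closure of its
interior are symmetric. -/
theorem ContDiffOn.iteratedFDerivWithin_comp_perm {s : Set E} {f : E → F} (hs : UniqueDiffOn ℝ s)
    (hs' : s ⊆ closure (interior s)) {n : ℕ} (hf : ContDiffOn ℝ (n : WithTop ℕ∞) f s)
    (σ : Equiv.Perm (Fin n)) {x : E} (hx : x ∈ s) (v : Fin n → E) :
    iteratedFDerivWithin ℝ n f s x (v ∘ σ) = iteratedFDerivWithin ℝ n f s x v := by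
  cases n with
  | zero => rw [Subsingleton.elim (v ∘ σ) v]
  | succ n =>
    have hσ : σ ∈ Submonoid.closure (Set.range fun i : Fin n => Equiv.swap i.castSucc i.succ) := by
      rw [Equiv.Perm.mclosure_swap_castSucc_succ]; trivial
    induction hσ using Submonoid.closure_induction generalizing v with
    | mem τ hτ =>
      obtain ⟨i, rfl⟩ := hτ
      exact iteratedFDerivWithin_comp_swap hs hs' hf i hx v
    | one => rfl
    | mul τ ρ _ _ h1 h2 =>
      rw [Equiv.Perm.coe_mul, ← Function.comp_assoc, h2, h1]

end Symmetry

/-! ### Taylor's theorem with Hölder remainder on the cube. -/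

/-- A form of Taylor's theorem: `ψ 0, …, ψ r` are successive derivatives. -/
theorem abs_sub_taylor_le : ∀ (r : ℕ) (ψ : ℕ → ℝ → ℝ) (C : ℝ),
    (∀ k < r, ∀ t ∈ Set.Icc (0 : ℝ) 1, HasDerivWithinAt (ψ k) (ψ (k + 1) t) (Set.Icc 0 1) t) →
    (∀ t ∈ Set.Icc (0 : ℝ) 1, |ψ r t - ψ r 0| ≤ C) →
    ∀ t ∈ Set.Icc (0 : ℝ) 1,
      |ψ 0 t - ∑ k ∈ Finset.range (r + 1), ψ k 0 * (t ^ k / k.factorial)| ≤ C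
  | 0, ψ, C, _, hC, t, ht => by simpa using hC t ht
  | r + 1, ψ, C, hd, hC, t, ht => by
    -- The remainder of the shifted sequence is the derivative of the present remainder, which
    -- vanishes at `0`; the mean value inequality on `[0, 1]` then preserves `C`.
    have ih := abs_sub_taylor_le r (fun k => ψ (k + 1)) C (fun k hk => hd (k + 1) (by omega)) hC
    have hder : ∀ u ∈ Set.Icc (0 : ℝ) 1, HasDerivWithinAt
        (fun t => ψ 0 t - ∑ k ∈ Finset.range (r + 1 + 1), ψ k 0 * (t ^ k / k.factorial))
        (ψ 1 u - ∑ k ∈ Finset.range (r + 1), ψ (k + 1) 0 * (u ^ k / k.factorial))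
        (Set.Icc 0 1) u := by
      intro u hu
      refine (hd 0 (by omega) u hu).sub ?_
      have h1 : HasDerivWithinAt
          (fun t : ℝ => ∑ k ∈ Finset.range (r + 1 + 1), ψ k 0 * (t ^ k / k.factorial))
          (∑ k ∈ Finset.range (r + 1 + 1), ψ k 0 * ((k * u ^ (k - 1)) / k.factorial))
          (Set.Icc 0 1) u := by
        refine HasDerivWithinAt.fun_sum fun k _ => ?_
        exact ((hasDerivWithinAt_pow k u).div_const _).const_mul _
      refine h1.congr_deriv ?_
      rw [Finset.sum_range_succ']
      simp only [Nat.cast_zero, zero_mul, zero_div, mul_zero, add_zero]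
      refine Finset.sum_congr rfl fun k _ => ?_
      congr 1
      rw [Nat.factorial_succ, Nat.add_sub_cancel]
      have : (k.factorial : ℝ) ≠ 0 := by positivity
      push_cast
      field_simp
    have hmv := (convex_Icc (0 : ℝ) 1).norm_image_sub_le_of_norm_hasDerivWithin_le hder
      (fun u hu => by simpa [Real.norm_eq_abs] using ih u hu) (Set.left_mem_Icc.2 zero_le_one) ht
    have h0 : ψ 0 0 - ∑ k ∈ Finset.range (r + 1 + 1), ψ k 0 * ((0 : ℝ) ^ k / k.factorial) = 0 := by
      rw [Finset.sum_range_succ']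
      simp
    simp only [h0, sub_zero, Real.norm_eq_abs] at hmv
    refine hmv.trans ?_
    rw [abs_of_nonneg ht.1]
    have hC0 : 0 ≤ C := (abs_nonneg _).trans (hC t ht)
    exact mul_le_of_le_one_right hC0 ht.2

theorem convex_unitCube (d : ℕ) : Convex ℝ (unitCube d) := convex_Icc 0 1

theorem interior_unitCube_nonempty (d : ℕ) : (interior (unitCube d)).Nonempty := by
  refine ⟨fun _ => 1 / 2, ?_⟩
  unfold unitCube
  rw [← Set.pi_univ_Icc, interior_pi_set Set.finite_univ]
  intro i _
  simp only [interior_Icc]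
  constructor <;> norm_num

theorem uniqueDiffOn_unitCube (d : ℕ) : UniqueDiffOn ℝ (unitCube d) :=
  uniqueDiffOn_convex (convex_unitCube d) (interior_unitCube_nonempty d)

theorem unitCube_subset_closure_interior (d : ℕ) :
    unitCube d ⊆ closure (interior (unitCube d)) := by
  rw [(convex_unitCube d).closure_interior_eq_closure_of_nonempty_interior
    (interior_unitCube_nonempty d)]
  exact subset_closure

theorem abs_partialDerivCube_le_one {d r : ℕ} {β : ℝ} {h : (Fin d → ℝ) → ℝ}
    (hh : h ∈ holderUnitBall d r β) {m : ℕ} (hm : m ≤ r) {γ : Fin d → ℕ}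
    (hγ : ∑ i, γ i = m) {x : Fin d → ℝ} (hx : x ∈ unitCube d) :
    |partialDerivCube γ h x| ≤ 1 := by
  have h1 := (le_self_add.trans hh.2 : _ ≤ (1 : ENNReal))
  rw [← ENNReal.ofReal_le_one]
  refine le_trans ?_ h1
  refine le_trans ?_ (Finset.single_le_sum (fun _ _ => zero_le)
    (Finset.mem_range.2 (Nat.lt_succ_of_le hm)))
  refine le_trans ?_ (Finset.single_le_sum (fun _ _ => zero_le)
    (show γ ∈ Finset.piAntidiag Finset.univ m by simp [hγ]))
  exact le_iSup₂ (f := fun x _ => ENNReal.ofReal |partialDerivCube γ h x|) x hx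

theorem abs_partialDerivCube_sub_le {d r : ℕ} {β : ℝ} (hβ : 0 < β) {h : (Fin d → ℝ) → ℝ}
    (hh : h ∈ holderUnitBall d r β) {γ : Fin d → ℕ}
    (hγ : ∑ i, γ i = r) {x y : Fin d → ℝ} (hx : x ∈ unitCube d) (hy : y ∈ unitCube d) :
    |partialDerivCube γ h x - partialDerivCube γ h y| ≤ ‖x - y‖ ^ β := by
  rcases eq_or_ne x y with rfl | hxy
  · simp [Real.zero_rpow hβ.ne']
  have h1 := (le_add_self.trans hh.2 : _ ≤ (1 : ENNReal))
  have hpos : 0 < ‖x - y‖ ^ β := Real.rpow_pos_of_pos (norm_pos_iff.2 (sub_ne_zero.2 hxy)) _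
  rw [← div_le_one hpos, ← ENNReal.ofReal_le_one]
  refine le_trans ?_ h1
  refine le_trans ?_ (le_iSup₂ γ (show γ ∈ Finset.piAntidiag Finset.univ r by simp [hγ]))
  refine le_trans ?_ (le_iSup₂ x hx)
  refine le_trans ?_ (le_iSup₂ y hy)
  exact le_iSup (fun _ : x ≠ y => ENNReal.ofReal
    (|partialDerivCube γ h x - partialDerivCube γ h y| / ‖x - y‖ ^ β)) hxy

/-- A derivative in coordinate directions is a partial derivative for a multi-index. -/
theorem exists_partialDerivCube_eq {d k : ℕ} (m : Fin k → Fin d) :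
    ∃ γ : Fin d → ℕ, ∑ i, γ i = k ∧ ∀ h : (Fin d → ℝ) → ℝ,
      ContDiffOn ℝ (k : WithTop ℕ∞) h (unitCube d) → ∀ x ∈ unitCube d,
      iteratedFDerivWithin ℝ k h (unitCube d) x (fun s => Pi.single (m s) 1) =
        partialDerivCube γ h x := by
  classical
  let γ : Fin d → ℕ := fun j => Fintype.card {s // m s = j}
  have hγ : ∑ i, γ i = k := by
    rw [← Fintype.card_sigma, Fintype.card_congr (Equiv.sigmaFiberEquiv m), Fintype.card_fin]
  -- This bijection sorts the slots by direction. Only sorted lists of directions occur in the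
  -- Hölder norm, whereas multilinear expansion produces arbitrary ones.
  let e : (Σ j, Fin (γ j)) ≃ Fin k :=
    (Equiv.sigmaCongrRight fun j => (Fintype.equivFin {s // m s = j}).symm).trans
      (Equiv.sigmaFiberEquiv m)
  have he : ∀ y, m (e y) = y.1 := fun y => ((Fintype.equivFin {s // m s = y.1}).symm y.2).2
  refine ⟨γ, hγ, fun h hh x hx => ?_⟩
  unfold partialDerivCube
  -- The orders `∑ i, γ i` and `k` agree only propositionally, hence the variable `n`.
  have key : ∀ (n : ℕ) (_ : n = k) (g : Fin n ≃ Fin k) (v : Fin k → Fin d → ℝ),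
      iteratedFDerivWithin ℝ n h (unitCube d) x (fun s => v (g s)) =
        iteratedFDerivWithin ℝ k h (unitCube d) x v := by
    intro n hn g v
    subst hn
    exact hh.iteratedFDerivWithin_comp_perm (uniqueDiffOn_unitCube d)
      (unitCube_subset_closure_interior d) g hx v
  rw [← key _ hγ (finSigmaFinEquiv.symm.trans e)]
  congr 1
  funext s
  simp only [Equiv.trans_apply, he]
  rfl

theorem abs_iteratedFDerivWithin_single_le_one {d r : ℕ} {β : ℝ} {h : (Fin d → ℝ) → ℝ}
    (hh : h ∈ holderUnitBall d r β) {k : ℕ} (hk : k ≤ r) (m : Fin k → Fin d)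
    {x : Fin d → ℝ} (hx : x ∈ unitCube d) :
    |iteratedFDerivWithin ℝ k h (unitCube d) x (fun s => Pi.single (m s) 1)| ≤ 1 := by
  obtain ⟨γ, hγ, H⟩ := exists_partialDerivCube_eq m
  rw [H h (hh.1.of_le (by exact_mod_cast hk)) x hx]
  exact abs_partialDerivCube_le_one hh hk hγ hx

theorem abs_iteratedFDerivWithin_single_sub_le {d r : ℕ} {β : ℝ} (hβ : 0 < β)
    {h : (Fin d → ℝ) → ℝ} (hh : h ∈ holderUnitBall d r β) (m : Fin r → Fin d)
    {x y : Fin d → ℝ} (hx : x ∈ unitCube d) (hy : y ∈ unitCube d) :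
    |iteratedFDerivWithin ℝ r h (unitCube d) x (fun s => Pi.single (m s) 1) -
      iteratedFDerivWithin ℝ r h (unitCube d) y (fun s => Pi.single (m s) 1)| ≤ ‖x - y‖ ^ β := by
  obtain ⟨γ, hγ, H⟩ := exists_partialDerivCube_eq m
  rw [H h hh.1 x hx, H h hh.1 y hy]
  exact abs_partialDerivCube_sub_le hβ hh hγ hx hy

theorem ContinuousMultilinearMap.apply_const_eq_sum {d k : ℕ}
    (T : ContinuousMultilinearMap ℝ (fun _ : Fin k => Fin d → ℝ) ℝ) (v : Fin d → ℝ) :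
    T (fun _ => v) = ∑ m : Fin k → Fin d,
      (∏ s, v (m s)) * T (fun s => Pi.single (m s) 1) := by
  classical
  have hv : v = ∑ j, v j • (Pi.single j 1 : Fin d → ℝ) := by
    funext i
    simp [Finset.sum_apply, Pi.single_apply]
  conv_lhs => rw [hv]
  rw [T.map_sum]
  refine Finset.sum_congr rfl fun m _ => ?_
  rw [T.map_smul_univ, smul_eq_mul]

/-- One-dimensional Taylor expansion along the segment from `y` to `x`. The top derivative expands
into `d ^ r` coordinate terms, each oscillating by at most `‖x - y‖ ^ r * ‖x - y‖ ^ β`. -/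
theorem abs_sub_taylor_unitCube_le {d r : ℕ} {β : ℝ} (hβ : 0 < β)
    {h : (Fin d → ℝ) → ℝ} (hh : h ∈ holderUnitBall d r β)
    {x y : Fin d → ℝ} (hx : x ∈ unitCube d) (hy : y ∈ unitCube d) :
    |h x - ∑ k ∈ Finset.range (r + 1),
      iteratedFDerivWithin ℝ k h (unitCube d) y (fun _ => x - y) * (1 / k.factorial)| ≤
      (d : ℝ) ^ r * ‖x - y‖ ^ ((r : ℝ) + β) := by
  set v := x - y with hv
  set ψ : ℕ → ℝ → ℝ := fun k t =>
    iteratedFDerivWithin ℝ k h (unitCube d) (y + t • v) (fun _ => v) with hψ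
  have hmem : ∀ t ∈ Set.Icc (0 : ℝ) 1, y + t • v ∈ unitCube d := fun t ht =>
    (convex_unitCube d).add_smul_sub_mem hy hx ht
  have hder : ∀ k < r, ∀ t ∈ Set.Icc (0 : ℝ) 1,
      HasDerivWithinAt (ψ k) (ψ (k + 1) t) (Set.Icc 0 1) t := by
    intro k hk t ht
    have hline : HasDerivWithinAt (fun t : ℝ => y + t • v) v (Set.Icc 0 1) t := by
      simpa using (((hasDerivAt_id t).smul_const v).const_add y).hasDerivWithinAt
    have hf : DifferentiableWithinAt ℝ (iteratedFDerivWithin ℝ k h (unitCube d)) (unitCube d)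
        (y + t • v) :=
      hh.1.differentiableOn_iteratedFDerivWithin (by exact_mod_cast hk)
        (uniqueDiffOn_unitCube d) _ (hmem t ht)
    have hf' : HasFDerivWithinAt
        (fun z => iteratedFDerivWithin ℝ k h (unitCube d) z (fun _ => v))
        (fderivWithin ℝ (fun z => iteratedFDerivWithin ℝ k h (unitCube d) z (fun _ => v))
          (unitCube d) (y + t • v)) (unitCube d) (y + t • v) :=
      (hf.continuousMultilinear_apply_const _).hasFDerivWithinAt
    have := hf'.comp_hasDerivWithinAt t hline hmem
    refine this.congr_deriv ?_
    simp only [hψ]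
    rw [iteratedFDerivWithin_succ_apply_eq (hh.1.of_le (by exact_mod_cast hk))
      (uniqueDiffOn_unitCube d) (hmem t ht)]
    rfl
  have hhol : ∀ t ∈ Set.Icc (0 : ℝ) 1,
      |ψ r t - ψ r 0| ≤ (d : ℝ) ^ r * ‖v‖ ^ ((r : ℝ) + β) := by
    intro t ht
    simp only [hψ]
    rw [ContinuousMultilinearMap.apply_const_eq_sum, ContinuousMultilinearMap.apply_const_eq_sum,
      ← Finset.sum_sub_distrib]
    refine (Finset.abs_sum_le_sum_abs _ _).trans ?_
    have hterm : ∀ m : Fin r → Fin d,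
        |(∏ s, v (m s)) * iteratedFDerivWithin ℝ r h (unitCube d) (y + t • v)
            (fun s => Pi.single (m s) 1) -
          (∏ s, v (m s)) * iteratedFDerivWithin ℝ r h (unitCube d) (y + (0 : ℝ) • v)
            (fun s => Pi.single (m s) 1)| ≤ ‖v‖ ^ ((r : ℝ) + β) := by
      intro m
      rw [← mul_sub, abs_mul, Real.rpow_add_of_nonneg (norm_nonneg _) (by positivity) hβ.le,
        Real.rpow_natCast]
      refine mul_le_mul ?_ ?_ (abs_nonneg _) (by positivity)
      · rw [Finset.abs_prod]
        refine (Finset.prod_le_prod (fun _ _ => abs_nonneg _)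
          (fun s _ => norm_le_pi_norm v (m s))).trans ?_
        simp
      · refine (abs_iteratedFDerivWithin_single_sub_le hβ hh m (hmem t ht)
          (hmem 0 (by simp))).trans ?_
        refine Real.rpow_le_rpow (norm_nonneg _) ?_ hβ.le
        rw [zero_smul, add_zero, add_sub_cancel_left, norm_smul, Real.norm_eq_abs,
          abs_of_nonneg ht.1]
        exact mul_le_of_le_one_left (norm_nonneg _) ht.2
    refine (Finset.sum_le_sum fun m _ => hterm m).trans (le_of_eq ?_)
    simp
  have := abs_sub_taylor_le r ψ _ hder hhol 1 (by simp)
  simpa [hψ, hv] using this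

/-! ### Local polynomials as sums of monomials. -/

/-- Indices of the monomials in the expansion of `∑ k ≤ r, ∑ m, ∏ s, (x (m s) - y (m s))`. -/
abbrev MonomialIndex (d r : ℕ) : Type :=
  Σ k : Fin (r + 1), (Fin k → Fin d) × Finset (Fin k)

/-- The factors of a monomial, padded by `none` to length `r`. -/
def MonomialIndex.factors {d r : ℕ} (q : MonomialIndex d r) : Fin r → Option (Fin d) :=
  fun s => if hs : (s : ℕ) < (q.1 : ℕ) then
    (if (⟨s, hs⟩ : Fin q.1) ∈ q.2.2 then some (q.2.1 ⟨s, hs⟩) else none) else none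

theorem prod_extend_one {M : Type*} [CommMonoid M] {m W : ℕ} (hmW : m ≤ W) (f : Fin m → M) :
    ∏ j : Fin W, (if h : (j : ℕ) < m then f ⟨j, h⟩ else 1) = ∏ j, f j := by
  obtain ⟨p, rfl⟩ := Nat.exists_eq_add_of_le hmW
  rw [Fin.prod_univ_add]
  simp

theorem MonomialIndex.prod_factors {d r : ℕ} (q : MonomialIndex d r) (x : Fin d → ℝ) :
    ∏ s, (q.factors s).elim 1 x = ∏ s ∈ q.2.2, x (q.2.1 s) := by
  have h1 : ∏ s ∈ q.2.2, x (q.2.1 s) = ∏ s, if s ∈ q.2.2 then x (q.2.1 s) else 1 := by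
    rw [Finset.prod_ite_mem, Finset.univ_inter]
  rw [h1, ← prod_extend_one (Nat.le_of_lt_succ q.1.2)]
  refine Finset.prod_congr rfl fun s _ => ?_
  unfold factors
  split_ifs <;> simp

/-- A function of the Hölder ball is locally approximated by a polynomial with coefficients
bounded by one. -/
theorem exists_local_polynomial {d r : ℕ} {β : ℝ} (hβ : 0 < β)
    {h : (Fin d → ℝ) → ℝ} (hh : h ∈ holderUnitBall d r β) {y : Fin d → ℝ} (hy : y ∈ unitCube d) :
    ∃ c : MonomialIndex d r → ℝ, (∀ q, |c q| ≤ 1) ∧ ∀ x ∈ unitCube d,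
      |h x - ∑ q, c q * ∏ s, (q.factors s).elim 1 x| ≤
        (d : ℝ) ^ r * ‖x - y‖ ^ ((r : ℝ) + β) := by
  classical
  -- Expanding `∏ s, (x (m s) - y (m s))` over subsets, the factors `-y` move into the coefficient.
  -- Equal monomials are not merged, so every coefficient stays bounded by one.
  refine ⟨fun q => iteratedFDerivWithin ℝ q.1 h (unitCube d) y (fun s => Pi.single (q.2.1 s) 1) *
    (1 / (q.1 : ℕ).factorial) * ∏ s ∈ q.2.2ᶜ, -(y (q.2.1 s)), ?_, ?_⟩
  · intro q
    rw [abs_mul, abs_mul]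
    have h1 := abs_iteratedFDerivWithin_single_le_one hh (Nat.le_of_lt_succ q.1.2) q.2.1 hy
    have h2 : |1 / ((q.1 : ℕ).factorial : ℝ)| ≤ 1 := by
      rw [abs_of_nonneg (by positivity)]
      refine div_le_one_of_le₀ ?_ (by positivity)
      exact_mod_cast Nat.one_le_iff_ne_zero.2 (Nat.factorial_ne_zero _)
    have h3 : |∏ s ∈ q.2.2ᶜ, -(y (q.2.1 s))| ≤ 1 := by
      rw [Finset.abs_prod]
      refine Finset.prod_le_one (fun _ _ => abs_nonneg _) fun s _ => ?_
      rw [abs_neg, abs_of_nonneg (hy.1 _)]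
      exact hy.2 _
    exact mul_le_one₀ (mul_le_one₀ h1 (abs_nonneg _) h2) (abs_nonneg _) h3
  · intro x hx
    refine le_of_eq_of_le ?_ (abs_sub_taylor_unitCube_le hβ hh hx hy)
    congr 2
    rw [← Finset.univ_sigma_univ, Finset.sum_sigma, ← Fin.sum_univ_eq_sum_range (fun k =>
      iteratedFDerivWithin ℝ k h (unitCube d) y (fun _ => x - y) * (1 / k.factorial))]
    refine Finset.sum_congr rfl fun k _ => ?_
    rw [ContinuousMultilinearMap.apply_const_eq_sum, Finset.sum_mul, Fintype.sum_prod_type]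
    refine Finset.sum_congr rfl fun m _ => ?_
    have : ∏ s, (x - y) (m s) = ∑ S : Finset (Fin k),
        (∏ s ∈ S, x (m s)) * ∏ s ∈ Sᶜ, -(y (m s)) := by
      have := Finset.prod_add (fun s => x (m s)) (fun s => -(y (m s))) Finset.univ
      simp only [Pi.sub_apply, sub_eq_add_neg, this, Finset.powerset_univ]
      rfl
    rw [this, Finset.sum_mul, Finset.sum_mul]
    refine Finset.sum_congr rfl fun S _ => ?_
    rw [MonomialIndex.prod_factors]
    ring

/-! ### The partition of unity by hat functions. -/

/-- The hat function. -/
noncomputable def hat (t : ℝ) : ℝ := max 0 (1 - |t|)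

theorem hat_nonneg (t : ℝ) : 0 ≤ hat t := le_max_left _ _

theorem hat_le_one (t : ℝ) : hat t ≤ 1 := max_le zero_le_one (by linarith [abs_nonneg t])

theorem hat_eq_zero {t : ℝ} (ht : 1 ≤ |t|) : hat t = 0 := max_eq_left (by linarith)

theorem abs_lt_one_of_hat_ne_zero {t : ℝ} (ht : hat t ≠ 0) : |t| < 1 := by
  by_contra h
  exact ht (hat_eq_zero (not_lt.1 h))

theorem sum_hat_eq_one (N : ℕ) {t : ℝ} (h0 : 0 ≤ t) (ht : t ≤ N) :
    ∑ i ∈ Finset.range (N + 1), hat (t - i) = 1 := by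
  induction N with
  | zero =>
    have : t = 0 := le_antisymm (by simpa using ht) h0
    simp [this, hat]
  | succ N ih =>
    push_cast at ht
    rw [Finset.sum_range_succ]
    rcases le_total t N with h | h
    · rw [ih h, hat_eq_zero, add_zero]
      push_cast
      rw [abs_of_nonpos (by linarith)]
      linarith
    · rw [Finset.sum_range_succ, Finset.sum_eq_zero]
      · unfold hat
        push_cast
        rw [abs_of_nonneg (by linarith), abs_of_nonpos (by linarith), max_eq_right (by linarith),
          max_eq_right (by linarith)]
        ring
      · intro i hi
        have : (i : ℝ) + 1 ≤ N := by exact_mod_cast Finset.mem_range.1 hi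
        refine hat_eq_zero ?_
        rw [abs_of_nonneg (by linarith)]
        linarith

theorem sum_prod_hat_eq_one {d N : ℕ} {x : Fin d → ℝ} (hx : x ∈ unitCube d) :
    ∑ i : Fin d → Fin (N + 1), ∏ j, hat (N * x j - (i j : ℕ)) = 1 := by
  rw [← Fintype.prod_sum (fun (j : Fin d) (i : Fin (N + 1)) => hat (N * x j - (i : ℕ)))]
  refine Finset.prod_eq_one fun j _ => ?_
  rw [Fin.sum_univ_eq_sum_range (fun i => hat (N * x j - (i : ℕ)))]
  have h0 : 0 ≤ x j := hx.1 j
  have h1 : x j ≤ 1 := hx.2 j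
  exact sum_hat_eq_one N (by positivity) (mul_le_of_le_one_right (by positivity) h1)

theorem card_filter_abs_sub_lt_one_le (N : ℕ) (t : ℝ) :
    (Finset.univ.filter fun i : Fin (N + 1) => |t - (i : ℕ)| < 1).card ≤ 2 := by
  refine (Finset.card_le_card_of_injOn (t := {⌊t⌋, ⌊t⌋ + 1})
    (fun i : Fin (N + 1) => ((i : ℕ) : ℤ)) ?_ ?_).trans Finset.card_le_two
  · intro i hi
    have hi' : |t - (i : ℕ)| < 1 := by simpa using hi
    rw [abs_lt] at hi'
    have h1 : ⌊t⌋ < ((i : ℕ) : ℤ) + 1 := by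
      rw [Int.floor_lt]; push_cast; linarith
    have h2 : ((i : ℕ) : ℤ) - 1 ≤ ⌊t⌋ := by
      rw [Int.le_floor]; push_cast; linarith
    simp only [Finset.coe_insert, Finset.coe_singleton, Set.mem_insert_iff,
      Set.mem_singleton_iff]
    omega
  · intro i _ j _ hij
    exact Fin.ext (Int.ofNat_inj.1 hij)

theorem card_filter_prod_hat_ne_zero_le {d N : ℕ} (x : Fin d → ℝ) :
    (Finset.univ.filter fun i : Fin d → Fin (N + 1) =>
      ∏ j, hat (N * x j - (i j : ℕ)) ≠ 0).card ≤ 2 ^ d := by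
  classical
  have hsub : (Finset.univ.filter fun i : Fin d → Fin (N + 1) =>
      ∏ j, hat (N * x j - (i j : ℕ)) ≠ 0) ⊆ Fintype.piFinset fun j =>
        Finset.univ.filter fun i : Fin (N + 1) => |N * x j - (i : ℕ)| < 1 := by
    intro i hi
    rw [Finset.mem_filter] at hi
    rw [Fintype.mem_piFinset]
    intro j
    rw [Finset.mem_filter]
    exact ⟨Finset.mem_univ _,
      abs_lt_one_of_hat_ne_zero (Finset.prod_ne_zero_iff.1 hi.2 j (Finset.mem_univ _))⟩
  refine (Finset.card_le_card hsub).trans ?_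
  rw [Fintype.card_piFinset]
  refine (Finset.prod_le_prod (fun _ _ => Nat.zero_le _)
    fun j _ => card_filter_abs_sub_lt_one_le N _).trans ?_
  simp

/-- Hat functions of affine functions are computed by two hidden layers. -/
theorem hiddenRep_hat_affine {d w : ℕ} {ι : Type} [Fintype ι] (A : ι → Fin d → ℝ) (b : ι → ℝ)
    {S : ℝ} (hS : ∑ l, (∑ i, A l i ^ 2 + b l ^ 2) ≤ S) (hd : d ≤ w)
    (hw : 2 * Fintype.card ι ≤ w) :
    HiddenRep 2 w ((2 * S + 1) * (3 * Fintype.card ι + 1))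
      (fun x l => hat (∑ i, A l i * x i + b l)) := by
  classical
  -- The signs realize `|t| = max 0 t + max 0 (-t)`: this doubles `S` in the first layer, and each
  -- hat costs two weights and one bias of modulus one in the second.
  let g : Bool → ℝ := fun s => if s then 1 else -1
  have hg : ∀ s, g s ^ 2 = 1 := by intro s; cases s <;> simp [g]
  have hS1 : ∑ k : ι × Bool, ∑ i, (g k.2 * A k.1 i) ^ 2 + ∑ k : ι × Bool, (g k.2 * b k.1) ^ 2 + 1
      ≤ 2 * S + 1 := by
    simp only [mul_pow, hg, one_mul]
    rw [← Finset.sum_add_distrib, Fintype.sum_prod_type]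
    simp only [Finset.sum_const, Finset.card_univ, Fintype.card_bool, nsmul_eq_mul]
    rw [← Finset.mul_sum]
    push_cast
    linarith
  have hS0 : 0 ≤ S := le_trans (Finset.sum_nonneg fun _ _ => by positivity) hS
  have hS2 : ∑ l : ι, ∑ k : ι × Bool, (if k.1 = l then -1 else 0 : ℝ) ^ 2 + ∑ _l : ι, (1 : ℝ) ^ 2
      + 1 ≤ 3 * Fintype.card ι + 1 := by
    simp only [Fintype.sum_prod_type, Finset.sum_const, ite_pow]
    simp
    linarith
  refine ((HiddenRep.first (fun (k : ι × Bool) i => g k.2 * A k.1 i) (fun k => g k.2 * b k.1)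
    hS1 hd).step (by positivity) (fun l k => if k.1 = l then -1 else 0) (fun _ => 1) hS2
    (by simpa [mul_comm] using hw)).congr ?_ le_rfl
  intro x l
  unfold hat
  congr 1
  have hin : ∀ k : ι × Bool, ∑ i, g k.2 * A k.1 i * x i + g k.2 * b k.1 =
      g k.2 * (∑ i, A k.1 i * x i + b k.1) := by
    intro k
    rw [mul_add, Finset.mul_sum]
    simp only [mul_assoc]
  simp only [hin, Fintype.sum_prod_type, Fintype.sum_bool, g]
  simp only [ite_mul, zero_mul, Finset.sum_add_distrib, Finset.sum_ite_eq', Finset.mem_univ,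
    if_true, one_mul, Bool.false_eq_true, if_false]
  set t := ∑ i, A l i * x i + b l
  rcases le_total 0 t with ht | ht
  · rw [abs_of_nonneg ht, max_eq_right ht, max_eq_left (by linarith)]; ring
  · rw [abs_of_nonpos ht, max_eq_left ht, max_eq_right (by linarith)]; ring

/-! ### Block functions and their sum. -/

/-- Blocks of the network: a grid cell together with a monomial. -/
abbrev BlockIndex (d r N : ℕ) : Type := (Fin d → Fin (N + 1)) × MonomialIndex d r

/-- The factors of a block: hat functions, coordinates and constants one. -/
abbrev FactorIndex (d r e : ℕ) : Type := (Fin d ⊕ Fin r) ⊕ Fin e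

/-- Every factor is a hat of an affine function, so that one pair of layers yields them all: on `[0,
1]` a coordinate `t` equals `hat (t - 1)`, and the constant one is `hat 0`. -/
def factorWeight {d r N e : ℕ} (p : BlockIndex d r N) : FactorIndex d r e → Fin d → ℝ
  | .inl (.inl j) => Pi.single j (N : ℝ)
  | .inl (.inr s) => (p.2.factors s).elim 0 fun j => Pi.single j 1
  | .inr _ => 0

def factorBias {d r N e : ℕ} (p : BlockIndex d r N) : FactorIndex d r e → ℝ
  | .inl (.inl j) => -((p.1 j : ℕ) : ℝ)
  | .inl (.inr s) => (p.2.factors s).elim 0 fun _ => -1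
  | .inr _ => 0

theorem sum_factorWeight_sq_add_le {d r N e : ℕ} (hN : 1 ≤ N) (p : BlockIndex d r N)
    (f : FactorIndex d r e) :
    ∑ i, factorWeight p f i ^ 2 + factorBias p f ^ 2 ≤ 2 * (N : ℝ) ^ 2 := by
  have hN' : (1 : ℝ) ≤ N := by exact_mod_cast hN
  have hsingle : ∀ (j : Fin d) (a : ℝ), ∑ i, (Pi.single j a : Fin d → ℝ) i ^ 2 = a ^ 2 := by
    intro j a
    rw [Finset.sum_eq_single j] <;> simp +contextual
  rcases f with (j | s) | u
  · simp only [factorWeight, factorBias, hsingle, neg_sq]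
    have : ((p.1 j : ℕ) : ℝ) ≤ N := by exact_mod_cast Nat.le_of_lt_succ (p.1 j).2
    have := pow_le_pow_left₀ (by positivity) this 2
    linarith
  · simp only [factorWeight, factorBias]
    cases p.2.factors s with
    | none => simp
    | some j =>
      simp only [Option.elim, hsingle]
      nlinarith
  · simp [factorWeight, factorBias]

theorem hat_factor_eq {d r N e : ℕ} (p : BlockIndex d r N) {x : Fin d → ℝ}
    (hx : x ∈ unitCube d) (f : FactorIndex d r e) :
    hat (∑ i, factorWeight p f i * x i + factorBias p f) =
      Sum.elim (Sum.elim (fun j => hat (N * x j - (p.1 j : ℕ)))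
        (fun s => (p.2.factors s).elim 1 x)) (fun _ => 1) f := by
  have hsingle : ∀ (j : Fin d) (a : ℝ), ∑ i, (Pi.single j a : Fin d → ℝ) i * x i = a * x j := by
    intro j a
    rw [Finset.sum_eq_single j] <;> simp +contextual
  rcases f with (j | s) | u
  · simp [factorWeight, factorBias, hsingle, sub_eq_add_neg]
  · simp only [factorWeight, factorBias, Sum.elim_inl, Sum.elim_inr]
    cases p.2.factors s with
    | none => simp [hat]
    | some j =>
      simp only [Option.elim, hsingle, hat]
      have h0 : 0 ≤ x j := hx.1 j
      have h1 : x j ≤ 1 := hx.2 j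
      rw [abs_of_nonpos (by linarith), max_eq_right (by linarith)]
      ring
  · simp [factorWeight, factorBias, hat]

/-- The approximate product of the factors of a block. -/
noncomputable def blockFun {d r N e : ℕ} (M L : ℕ) (g : (Fin L → Bool) ≃ FactorIndex d r e)
    (p : BlockIndex d r N) (x : Fin d → ℝ) : ℝ :=
  treeProd M L fun l => hat (∑ i, factorWeight p (g l) i * x i + factorBias p (g l))

theorem blockFun_eq_zero {d r N e M L : ℕ} (hM : 1 ≤ M)
    (g : (Fin L → Bool) ≃ FactorIndex d r e) (p : BlockIndex d r N) {x : Fin d → ℝ}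
    (hx : x ∈ unitCube d) (h0 : ∏ j, hat (N * x j - (p.1 j : ℕ)) = 0) :
    blockFun M L g p x = 0 := by
  obtain ⟨j, _, hj⟩ := Finset.prod_eq_zero_iff.1 h0
  refine treeProd_eq_zero hM L _ (fun l => hat_nonneg _) ⟨g.symm (.inl (.inl j)), ?_⟩
  rw [Equiv.apply_symm_apply, hat_factor_eq p hx]
  exact hj

theorem abs_blockFun_sub_le {d r N e M L : ℕ} (hM : 1 ≤ M)
    (g : (Fin L → Bool) ≃ FactorIndex d r e) (p : BlockIndex d r N) {x : Fin d → ℝ}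
    (hx : x ∈ unitCube d) :
    |blockFun M L g p x -
      (∏ j, hat (N * x j - (p.1 j : ℕ))) * ∏ s, (p.2.factors s).elim 1 x| ≤
      2 ^ L * (2 / (M : ℝ) ^ 2) := by
  refine le_of_eq_of_le ?_ (abs_treeProd_sub_prod_le hM L
    (fun l => hat (∑ i, factorWeight p (g l) i * x i + factorBias p (g l)))
    fun l => ⟨hat_nonneg _, hat_le_one _⟩)
  rw [Equiv.prod_comp g (fun f => hat (∑ i, factorWeight p f i * x i + factorBias p f))]
  simp only [hat_factor_eq p hx]
  rw [Fintype.prod_sum_type, Fintype.prod_sum_type]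
  simp [blockFun, hat_factor_eq p hx]

/-- The exponent `2 * L + 3` counts one factor `n` for each of the two hat layers, the `2 * L` tree
layers and the output; `N ^ 2` comes from the slopes and biases of the hats. -/
theorem exists_net_sum_blockFun {d r N e M L w n : ℕ} (hN : 1 ≤ N) (hM : 1 ≤ M)
    (g : (Fin L → Bool) ≃ FactorIndex d r e) (c : BlockIndex d r N → ℝ) (hc : ∀ p, |c p| ≤ 1)
    (hn : Fintype.card (BlockIndex d r N) * 2 ^ L = n) (hn1 : 1 ≤ n) (hdw : d ≤ w)
    (hw : 3 * M * n ≤ w) :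
    ∃ θ : ReLUNet 1 (2 + 2 * L) d, (∀ x, θ.realize x 0 = ∑ p, c p * blockFun M L g p x) ∧
      θ.width ≤ w ∧ θ.kappa ^ 2 ≤ 20 * 13 ^ (2 * L) * (N : ℝ) ^ 2 * (n : ℝ) ^ (2 * L + 3) := by
  have hMn : 3 * n ≤ 3 * M * n := Nat.mul_le_mul_right _ (by omega)
  have hPn : Fintype.card (BlockIndex d r N) ≤ n := by
    rw [← hn]; exact Nat.le_mul_of_pos_right _ (by positivity)
  have hcard : Fintype.card (BlockIndex d r N × (Fin L → Bool)) = n := by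
    rw [Fintype.card_prod, ← hn]; simp
  have h1 := hiddenRep_hat_affine (w := w)
    (fun y : BlockIndex d r N × (Fin L → Bool) => factorWeight y.1 (g y.2))
    (fun y => factorBias y.1 (g y.2)) (S := n * (2 * (N : ℝ) ^ 2)) (by
      refine (Finset.sum_le_sum fun y _ => sum_factorWeight_sq_add_le hN y.1 (g y.2)).trans ?_
      rw [Finset.sum_const, Finset.card_univ, hcard, nsmul_eq_mul]) hdw (by rw [hcard]; omega)
  obtain ⟨θ, ht1, ht2, ht3⟩ := (HiddenRep.treeProd (n := n) hM L h1 (by positivity) hn1 hn.le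
    hw).output c (by omega) (by omega)
  refine ⟨θ, ht1, ht2, ht3.trans ?_⟩
  have hsum : ∑ p, c p ^ 2 ≤ n := by
    refine (Finset.sum_le_sum (g := fun _ => (1 : ℝ)) fun p _ => ?_).trans ?_
    · rw [← sq_abs]
      exact pow_le_one₀ (abs_nonneg _) (hc p)
    · rw [Finset.sum_const, Finset.card_univ, nsmul_eq_mul, mul_one]
      exact_mod_cast hPn
  have hn' : (1 : ℝ) ≤ n := by exact_mod_cast hn1
  have hN' : (1 : ℝ) ≤ N := by exact_mod_cast hN
  have hnN : 1 ≤ n * (N : ℝ) ^ 2 := one_le_mul_of_one_le_of_one_le hn' (one_le_pow₀ hN')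
  rw [hcard]
  have e1 : 2 * (n * (2 * (N : ℝ) ^ 2)) + 1 ≤ 5 * (n * (N : ℝ) ^ 2) := by linarith
  have e2 : 3 * (n : ℝ) + 1 ≤ 4 * n := by linarith
  calc _ ≤ 5 * (n * (N : ℝ) ^ 2) * (4 * n) * (13 * n) ^ (2 * L) * n := by gcongr
    _ = _ := by rw [mul_pow]; ring

theorem abs_sub_sum_blockFun_le {d r N e M L : ℕ} {β : ℝ} (hβ : 0 < β) (hN : 1 ≤ N) (hM : 1 ≤ M)
    (g : (Fin L → Bool) ≃ FactorIndex d r e) {h : (Fin d → ℝ) → ℝ}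
    (hh : h ∈ holderUnitBall d r β) :
    ∃ c : BlockIndex d r N → ℝ, (∀ p, |c p| ≤ 1) ∧ ∀ x ∈ unitCube d,
      |h x - ∑ p, c p * blockFun M L g p x| ≤
        (d : ℝ) ^ r * (1 / N) ^ ((r : ℝ) + β) +
          2 ^ d * (Fintype.card (MonomialIndex d r) * (2 ^ L * (2 / (M : ℝ) ^ 2))) := by
  have hN' : (0 : ℝ) < N := by exact_mod_cast hN
  let y : (Fin d → Fin (N + 1)) → Fin d → ℝ := fun i j => ((i j : ℕ) : ℝ) / N
  have hy : ∀ i, y i ∈ unitCube d := by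
    intro i
    refine ⟨fun j => ?_, fun j => ?_⟩
    · simp only [y, Pi.zero_apply]; positivity
    · simp only [y, Pi.one_apply]
      rw [div_le_one hN']
      exact_mod_cast Nat.le_of_lt_succ (i j).2
  choose c hc1 hc2 using fun i => exists_local_polynomial hβ hh (hy i)
  refine ⟨fun p => c p.1 p.2, fun p => hc1 _ _, fun x hx => ?_⟩
  set Ψ : (Fin d → Fin (N + 1)) → ℝ := fun i => ∏ j, hat (N * x j - (i j : ℕ)) with hΨ
  have hΨ0 : ∀ i, 0 ≤ Ψ i := fun i => Finset.prod_nonneg fun j _ => hat_nonneg _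
  have hsum : ∑ i, Ψ i = 1 := sum_prod_hat_eq_one hx
  let mon : MonomialIndex d r → ℝ := fun q => ∏ s, (q.factors s).elim 1 x
  set δ : ℝ := 2 ^ L * (2 / (M : ℝ) ^ 2) with hδ
  have hδ0 : 0 ≤ δ := by positivity
  -- The first sum averages Taylor errors over cells with `‖x - y i‖ ≤ 1 / N`. The second collects
  -- product errors, which vanish on all but `2 ^ d` cells.
  have hdecomp : h x - ∑ p : BlockIndex d r N, c p.1 p.2 * blockFun M L g p x =
      ∑ i, Ψ i * (h x - ∑ q, c i q * mon q) +
        ∑ i, ∑ q, c i q * (Ψ i * mon q - blockFun M L g (i, q) x) := by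
    rw [Fintype.sum_prod_type]
    simp only [mul_sub, Finset.sum_sub_distrib]
    rw [← Finset.sum_mul, hsum, one_mul]
    have : ∀ i, Ψ i * ∑ q, c i q * mon q = ∑ q, c i q * (Ψ i * mon q) := by
      intro i
      rw [Finset.mul_sum]
      exact Finset.sum_congr rfl fun q _ => by ring
    simp only [this]
    ring
  rw [hdecomp]
  refine (abs_add_le _ _).trans (add_le_add ?_ ?_)
  · refine (Finset.abs_sum_le_sum_abs _ _).trans ?_
    have hterm : ∀ i, |Ψ i * (h x - ∑ q, c i q * mon q)| ≤
        Ψ i * ((d : ℝ) ^ r * (1 / N) ^ ((r : ℝ) + β)) := by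
      intro i
      rw [abs_mul, abs_of_nonneg (hΨ0 i)]
      rcases eq_or_ne (Ψ i) 0 with h0 | h0
      · simp [h0]
      refine mul_le_mul_of_nonneg_left ((hc2 i x hx).trans ?_) (hΨ0 i)
      refine mul_le_mul_of_nonneg_left ?_ (by positivity)
      refine Real.rpow_le_rpow (norm_nonneg _) ?_ (by positivity)
      rw [pi_norm_le_iff_of_nonneg (by positivity)]
      intro j
      have hj := abs_lt_one_of_hat_ne_zero (Finset.prod_ne_zero_iff.1 h0 j (Finset.mem_univ _))
      have e : (x - y i) j = (N * x j - (i j : ℕ)) / N := by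
        simp only [Pi.sub_apply, y]
        field_simp
      rw [e, Real.norm_eq_abs, abs_div, abs_of_pos hN']
      gcongr
    refine (Finset.sum_le_sum fun i _ => hterm i).trans (le_of_eq ?_)
    rw [← Finset.sum_mul, hsum, one_mul]
  · refine (Finset.abs_sum_le_sum_abs _ _).trans ?_
    have hterm : ∀ i, |∑ q, c i q * (Ψ i * mon q - blockFun M L g (i, q) x)| ≤
        if Ψ i ≠ 0 then Fintype.card (MonomialIndex d r) * δ else 0 := by
      intro i
      split_ifs with h0
      · refine (Finset.abs_sum_le_sum_abs _ _).trans ?_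
        refine (Finset.sum_le_sum (g := fun _ => δ) fun q _ => ?_).trans (le_of_eq (by simp))
        rw [abs_mul, abs_sub_comm]
        refine (mul_le_mul (hc1 i q) (abs_blockFun_sub_le hM g (i, q) hx) (abs_nonneg _)
          zero_le_one).trans (le_of_eq (one_mul _))
      · rw [not_not] at h0
        rw [Finset.sum_eq_zero, abs_zero]
        intro q _
        rw [blockFun_eq_zero hM g (i, q) hx h0, h0]
        simp
    refine (Finset.sum_le_sum fun i _ => hterm i).trans ?_
    rw [← Finset.sum_filter, Finset.sum_const, nsmul_eq_mul]
    refine mul_le_mul_of_nonneg_right ?_ (by positivity)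
    exact_mod_cast card_filter_prod_hat_ne_zero_le (N := N) x

/-! ### Choice of the grid and conclusion. -/

theorem exists_zero_net : ∀ (D n : ℕ), ∃ θ : ReLUNet 1 D n,
    (∀ x, θ.realize x 0 = 0) ∧ θ.width ≤ max n 1 ∧ θ.kappa = 0
  | 0, n => ⟨.output 0, fun x => by simp [ReLUNet.realize], le_rfl,
      by simp [ReLUNet.kappa, frobeniusSq]⟩
  | D + 1, n => by
    obtain ⟨θ, h1, h2, h3⟩ := exists_zero_net D 1
    refine ⟨.hidden 0 0 θ, fun x => h1 _, ?_, by simp [ReLUNet.kappa, h3]⟩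
    simp only [ReLUNet.width]
    exact max_le_max le_rfl h2

theorem card_blockIndex_mul_le {d r N L : ℕ} (hN : 1 ≤ N) :
    Fintype.card (BlockIndex d r N) * 2 ^ L ≤
      2 ^ d * Fintype.card (MonomialIndex d r) * 2 ^ L * N ^ d := by
  have h1 : (N + 1) ^ d ≤ 2 ^ d * N ^ d := by
    rw [← mul_pow]
    exact Nat.pow_le_pow_left (by omega) d
  have h2 : Fintype.card (BlockIndex d r N) =
      (N + 1) ^ d * Fintype.card (MonomialIndex d r) := by
    rw [Fintype.card_prod]; simp
  rw [h2]
  calc _ ≤ 2 ^ d * N ^ d * Fintype.card (MonomialIndex d r) * 2 ^ L := by gcongr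
    _ = _ := by ring

/-- The approximation at grid resolution `N`. -/
theorem exists_net_of_grid {d r L : ℕ} (hL : d + r ≤ 2 ^ L) {β : ℝ} (hβ : 0 < β) :
    ∃ C : ℕ, 1 ≤ C ∧ ∀ N : ℕ, 1 ≤ N → ∀ W : ℕ,
      (C : ℝ) * (N : ℝ) ^ ((d : ℝ) + ((r : ℝ) + β) / 2) + d ≤ W → ∀ h ∈ holderUnitBall d r β,
      ∃ θ : ReLUNet 1 (2 + 2 * L) d, θ.width ≤ W ∧
        θ.kappa ^ 2 ≤ C * (N : ℝ) ^ (2 + d * (2 * L + 3)) ∧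
        ∀ x ∈ unitCube d, |h x - θ.realize x 0| ≤ C * (N : ℝ) ^ (-((r : ℝ) + β)) := by
  set α : ℝ := (r : ℝ) + β with hα
  have hα0 : 0 < α := by positivity
  set c : ℕ := 2 ^ d * Fintype.card (MonomialIndex d r) * 2 ^ L with hc
  have hQ : 1 ≤ Fintype.card (MonomialIndex d r) :=
    Fintype.card_pos_iff.2 ⟨⟨0, fun s => s.elim0, ∅⟩⟩
  -- The three summands serve the norm, the width and the error, in this order.
  refine ⟨20 * 13 ^ (2 * L) * c ^ (2 * L + 3) + 6 * c + (d ^ r + 2 * c),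
    by have : 1 ≤ c := Nat.one_le_iff_ne_zero.2 (by positivity)
       omega, ?_⟩
  intro N hN W hW h hh
  have hN' : (1 : ℝ) ≤ N := by exact_mod_cast hN
  have hN0 : (0 : ℝ) < N := by linarith
  let g : (Fin L → Bool) ≃ FactorIndex d r (2 ^ L - (d + r)) := Fintype.equivOfCardEq (by
    simp; omega)
  -- The least order of `M` for which the product error `2 / M ^ 2` is at most of the size `N ^
  -- (-α)`.
  set M : ℕ := ⌈(N : ℝ) ^ (α / 2)⌉₊ with hM
  have hNα : (1 : ℝ) ≤ (N : ℝ) ^ (α / 2) := Real.one_le_rpow hN' (by positivity)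
  have hM1 : 1 ≤ M := Nat.one_le_ceil_iff.2 (by linarith)
  have hMle : (M : ℝ) ≤ 2 * (N : ℝ) ^ (α / 2) := by
    have := (Nat.ceil_lt_add_one (by linarith : (0 : ℝ) ≤ (N : ℝ) ^ (α / 2))).le
    linarith
  have hMge : (N : ℝ) ^ (α / 2) ≤ M := Nat.le_ceil _
  set n : ℕ := Fintype.card (BlockIndex d r N) * 2 ^ L with hn
  have hn1 : 1 ≤ n := Nat.one_le_iff_ne_zero.2 (by
    have : 0 < Fintype.card (BlockIndex d r N) := Fintype.card_pos_iff.2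
      ⟨(fun _ => 0, ⟨0, fun s => s.elim0, ∅⟩)⟩
    positivity)
  have hnc : n ≤ c * N ^ d := card_blockIndex_mul_le hN
  have hnc' : (n : ℝ) ≤ c * (N : ℝ) ^ d := by exact_mod_cast hnc
  push_cast at hW
  have hpos1 : (0 : ℝ) ≤ 20 * 13 ^ (2 * L) * (c : ℝ) ^ (2 * L + 3) := by positivity
  have hpos2 : (0 : ℝ) ≤ (d : ℝ) ^ r + 2 * c := by positivity
  have hpow : (0 : ℝ) ≤ (N : ℝ) ^ ((d : ℝ) + α / 2) := by positivity
  have hMn : 3 * M * n ≤ W := by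
    have : (3 : ℝ) * M * n ≤ W := by
      calc (3 : ℝ) * M * n ≤ 3 * (2 * (N : ℝ) ^ (α / 2)) * (c * (N : ℝ) ^ d) := by gcongr
        _ = 6 * c * (N : ℝ) ^ ((d : ℝ) + α / 2) := by
          rw [Real.rpow_add hN0, Real.rpow_natCast]; ring
        _ ≤ W := by
          have h1 := mul_nonneg (add_nonneg hpos1 hpos2) hpow
          have : (0 : ℝ) ≤ d := by positivity
          nlinarith
    exact_mod_cast this
  have hdW : d ≤ W := by
    have : (d : ℝ) ≤ W := by
      refine le_trans ?_ hW
      have : (0 : ℝ) ≤ (20 * 13 ^ (2 * L) * (c : ℝ) ^ (2 * L + 3) + 6 * c + ((d : ℝ) ^ r + 2 * c)) *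
        (N : ℝ) ^ ((d : ℝ) + α / 2) := by positivity
      linarith
    exact_mod_cast this
  obtain ⟨a, ha1, ha2⟩ := abs_sub_sum_blockFun_le hβ hN hM1 g hh
  obtain ⟨θ, ht1, ht2, ht3⟩ := exists_net_sum_blockFun hN hM1 g a ha1 rfl hn1 hdW hMn
  refine ⟨θ, ht2, ht3.trans ?_, fun x hx => ?_⟩
  · calc 20 * 13 ^ (2 * L) * (N : ℝ) ^ 2 * (n : ℝ) ^ (2 * L + 3)
        ≤ 20 * 13 ^ (2 * L) * (N : ℝ) ^ 2 * (c * (N : ℝ) ^ d) ^ (2 * L + 3) := by gcongr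
      _ = 20 * 13 ^ (2 * L) * (c : ℝ) ^ (2 * L + 3) * (N : ℝ) ^ (2 + d * (2 * L + 3)) := by
        rw [mul_pow, ← pow_mul, pow_add]; ring
      _ ≤ _ := by
        push_cast
        refine mul_le_mul_of_nonneg_right ?_ (by positivity)
        have : (0 : ℝ) ≤ 6 * c := by positivity
        linarith
  · rw [ht1]
    refine (ha2 x hx).trans ?_
    have e1 : (1 / (N : ℝ)) ^ α = (N : ℝ) ^ (-α) := by
      rw [Real.rpow_neg hN0.le, one_div, Real.inv_rpow hN0.le]
    have e2 : 2 / (M : ℝ) ^ 2 ≤ 2 * (N : ℝ) ^ (-α) := by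
      have h1 : (N : ℝ) ^ α ≤ (M : ℝ) ^ 2 := by
        calc (N : ℝ) ^ α = ((N : ℝ) ^ (α / 2)) ^ 2 := by
              rw [← Real.rpow_natCast, ← Real.rpow_mul hN0.le]; congr 1; push_cast; ring
          _ ≤ _ := by gcongr
      rw [Real.rpow_neg hN0.le, ← div_eq_mul_inv]
      have : 0 < (N : ℝ) ^ α := Real.rpow_pos_of_pos hN0 _
      gcongr
    rw [e1]
    have e3 : (2 : ℝ) ^ d * (Fintype.card (MonomialIndex d r) * (2 ^ L * (2 / (M : ℝ) ^ 2))) ≤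
        2 * c * (N : ℝ) ^ (-α) := by
      calc _ ≤ (2 : ℝ) ^ d * (Fintype.card (MonomialIndex d r) *
            (2 ^ L * (2 * (N : ℝ) ^ (-α)))) := by gcongr
        _ = _ := by rw [hc]; push_cast; ring
    have hp : 0 ≤ (N : ℝ) ^ (-α) := by positivity
    have h6 : (0 : ℝ) ≤ 6 * c := by positivity
    push_cast
    have := mul_nonneg (add_nonneg hpos1 h6) hp
    nlinarith

theorem add_le_two_pow_ceil_logb {d r : ℕ} (hd : 1 ≤ d) :
    d + r ≤ 2 ^ ⌈Real.logb 2 ((d : ℝ) + (r : ℝ))⌉₊ := by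
  have h0 : (0 : ℝ) < (d : ℝ) + r := by
    have : (1 : ℝ) ≤ d := by exact_mod_cast hd
    positivity
  have h1 := Nat.le_ceil (Real.logb 2 ((d : ℝ) + (r : ℝ)))
  rw [Real.logb_le_iff_le_rpow (by norm_num) h0, Real.rpow_natCast] at h1
  exact_mod_cast h1

theorem abs_le_one_of_mem_holderUnitBall {d r : ℕ} {β : ℝ} {h : (Fin d → ℝ) → ℝ}
    (hh : h ∈ holderUnitBall d r β) {x : Fin d → ℝ} (hx : x ∈ unitCube d) : |h x| ≤ 1 := by
  have := abs_iteratedFDerivWithin_single_le_one hh (Nat.zero_le r) (fun s => s.elim0) hx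
  simpa using this

theorem theorem1 (d r : ℕ) (hd : 1 ≤ d) (β : ℝ) (hβ0 : 0 < β) (hβ1 : β ≤ 1)
    (α : ℝ) (hα : α = (r : ℝ) + β)
    (D : ℕ) (hD : D = 2 * ⌈Real.logb 2 ((d : ℝ) + (r : ℝ))⌉₊ + 2) :
    ∃ c₁ c₂ : ℝ, 0 < c₁ ∧ 0 < c₂ ∧
      ∀ K : ℝ, 1 ≤ K →
      ∀ W : ℕ, c₁ * K ^ ((2 * (d : ℝ) + α) / ((d : ℝ) * ((D : ℝ) + 1) + 2)) ≤ (W : ℝ) →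
      ∀ h ∈ holderUnitBall d r β,
        ∃ φ ∈ normConstrainedNN d 1 W D K,
          ∀ x ∈ unitCube d,
            |h x - φ x 0| ≤ c₂ * K ^ (-(2 * α) / (2 + (d : ℝ) * ((D : ℝ) + 1))) := by
  have hL := add_le_two_pow_ceil_logb (r := r) hd
  set L : ℕ := ⌈Real.logb 2 ((d : ℝ) + (r : ℝ))⌉₊
  -- The successor form exhibits a hidden layer, as `exists_width_eq` requires.
  have hD' : D = 2 * L + 1 + 1 := hD
  obtain ⟨C, hC1, hC⟩ := exists_net_of_grid hL hβ0
  rw [← hα, show 2 + 2 * L = D by omega] at hC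
  have hα0 : 0 < α := by rw [hα]; positivity
  have hC' : (1 : ℝ) ≤ C := by exact_mod_cast hC1
  set E : ℝ := 2 + (d : ℝ) * ((D : ℝ) + 1) with hE
  have hE0 : 0 < E := by positivity
  have hEn : ((2 + d * (2 * L + 3) : ℕ) : ℝ) = E := by
    rw [hE, hD]; push_cast; ring
  have hd' : (1 : ℝ) ≤ d := by exact_mod_cast hd
  -- Dividing the resolution by `Y` absorbs the constant of the norm bound: `C * (X / Y) ^ E = K ^
  -- 2` for `X = K ^ (2 / E)`.
  set Y : ℝ := (C : ℝ) ^ (1 / E) with hY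
  have hY1 : 1 ≤ Y := Real.one_le_rpow hC' (by positivity)
  refine ⟨C + d, C * 2 ^ α * Y ^ α, by positivity, by positivity, ?_⟩
  intro K hK W hW h hh
  have hK0 : (0 : ℝ) < K := by linarith
  set X : ℝ := K ^ (2 / E) with hX
  have hX1 : 1 ≤ X := Real.one_le_rpow hK (by positivity)
  have hX0 : 0 < X := by linarith
  have hY0 : 0 < Y := by linarith
  have hXα : K ^ (-(2 * α) / E) = X ^ (-α) := by
    rw [hX, ← Real.rpow_mul hK0.le]; congr 1; ring
  have hXW : K ^ ((2 * (d : ℝ) + α) / ((d : ℝ) * ((D : ℝ) + 1) + 2)) = X ^ ((d : ℝ) + α / 2) := by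
    rw [hX, ← Real.rpow_mul hK0.le]; congr 1; rw [hE]; field_simp; ring
  rw [hXW] at hW
  rw [hXα]
  have hXp : 1 ≤ X ^ ((d : ℝ) + α / 2) := Real.one_le_rpow hX1 (by positivity)
  have hdW : (d : ℝ) ≤ W := by
    refine le_trans ?_ hW
    nlinarith
  have hdW' : d ≤ W := by exact_mod_cast hdW
  suffices H : ∃ θ : ReLUNet 1 D d, θ.width ≤ W ∧ θ.kappa ≤ K ∧ ∀ x ∈ unitCube d,
      |h x - θ.realize x 0| ≤ C * 2 ^ α * Y ^ α * X ^ (-α) by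
    subst hD'
    obtain ⟨θ, h1, h2, h3⟩ := H
    obtain ⟨θ', g1, g2, g3⟩ := exists_width_eq θ h1
    exact ⟨θ.realize, ⟨θ', g2, g3.trans_le h2, g1⟩, h3⟩
  have hρ : (X / Y) ^ (-α) = Y ^ α * X ^ (-α) := by
    rw [Real.div_rpow hX0.le hY0.le, Real.rpow_neg hY0.le, div_inv_eq_mul, mul_comm]
  have hρ0 : 0 < X / Y := div_pos hX0 hY0
  rw [mul_assoc, ← hρ]
  -- For `X / Y < 1` no grid fits the norm budget, but the claimed error then exceeds `1 ≥ |h x|` or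
  -- equals it, so the zero network suffices.
  rcases lt_or_ge (X / Y) 1 with hlt | hge
  · obtain ⟨θ, h1, h2, h3⟩ := exists_zero_net D d
    refine ⟨θ, by omega, by linarith, fun x hx => ?_⟩
    rw [h1, sub_zero]
    refine (abs_le_one_of_mem_holderUnitBall hh hx).trans ?_
    have p1 : (1 : ℝ) ≤ 2 ^ α := Real.one_le_rpow (by norm_num) hα0.le
    have p2 : 1 ≤ (X / Y) ^ (-α) :=
      Real.one_le_rpow_of_pos_of_le_one_of_nonpos hρ0 hlt.le (by linarith)
    exact one_le_mul_of_one_le_of_one_le (one_le_mul_of_one_le_of_one_le hC' p1) p2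
  · set N : ℕ := ⌊X / Y⌋₊ with hN
    have hN1 : 1 ≤ N := Nat.one_le_floor_iff _ |>.2 hge
    have hN1' : (1 : ℝ) ≤ N := by exact_mod_cast hN1
    have hNle : (N : ℝ) ≤ X / Y := Nat.floor_le hρ0.le
    -- Rounding down a number that is at least one loses at most a factor two, whence the `2 ^ α` in
    -- `c₂`.
    have hNge : X / Y / 2 ≤ N := by
      have := Nat.lt_floor_add_one (X / Y)
      linarith
    have hNX : (N : ℝ) ≤ X := hNle.trans (div_le_self hX0.le hY1)
    obtain ⟨θ, h1, h2, h3⟩ := hC N hN1 W (by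
      refine le_trans ?_ hW
      have : (N : ℝ) ^ ((d : ℝ) + α / 2) ≤ X ^ ((d : ℝ) + α / 2) := by gcongr
      nlinarith) h hh
    refine ⟨θ, h1, ?_, fun x hx => (h3 x hx).trans ?_⟩
    · refine (sq_le_sq₀ (kappa_nonneg θ) hK0.le).1 ?_
      refine h2.trans ?_
      have hXE : X ^ E = K ^ 2 := by
        rw [hX, ← Real.rpow_mul hK0.le, div_mul_cancel₀ _ hE0.ne']
        exact_mod_cast Real.rpow_natCast K 2
      have hYE : Y ^ E = C := by
        rw [hY, ← Real.rpow_mul (by positivity), one_div_mul_cancel hE0.ne', Real.rpow_one]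
      calc (C : ℝ) * (N : ℝ) ^ (2 + d * (2 * L + 3)) = C * (N : ℝ) ^ E := by
            rw [← hEn, Real.rpow_natCast]
        _ ≤ C * (X / Y) ^ E := by gcongr
        _ = K ^ 2 := by
          rw [Real.div_rpow hX0.le hY0.le, hXE, hYE]
          field_simp
    · rw [mul_assoc]
      refine mul_le_mul_of_nonneg_left ?_ (by positivity)
      calc (N : ℝ) ^ (-α) ≤ (X / Y / 2) ^ (-α) :=
            Real.rpow_le_rpow_of_nonpos (by positivity) hNge (by linarith)
        _ = 2 ^ α * (X / Y) ^ (-α) := by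
          rw [Real.div_rpow hρ0.le (by norm_num), Real.rpow_neg (by norm_num : (0 : ℝ) ≤ 2),
            div_inv_eq_mul, mul_comm]
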